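/- Let $k$ be an algebraically closed field of characteristic $0$, and let $f=(F,G):\mathbb{A}^2_k\to\mathbb{A}^2_k$, $F,G\in k[x,y]$, be a dominant polynomial endomorphism. Suppose that $f$ is birational, i.e. that there is a rational map $h:\mathbb{A}^2_k\dashrightarrow\mathbb{A}^2_k$ with $f\circ h=\mathrm{id}$ and $h\circ f=\mathrm{id}$ as rational maps. Then either there is a nonconstant rational function $g\in k(x,y)$ satisfying $g\circ f=g$, or there is a point $p\in\mathbb{A}^2(k)$ whose forward orbit $\{f^n(p)\mid n\ge 0\}$ is Zariski dense in $\mathbb{A}^2_k$. -/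

import Mathlib

open MvPolynomial

noncomputable section

namespace AffinePlane

/-- The closed points `𝔸²(k)` of the affine plane, in the fixed affine coordinates. -/
abbrev Point (k : Type*) := Fin 2 → k

/-- A polynomial endomorphism `(x, y) ↦ (F(x, y), G(x, y))` of `𝔸²` over `k`,
given by its two components `F, G ∈ k[x, y]`. -/
abbrev PolyEnd (k : Type*) [Field k] := Fin 2 → MvPolynomial (Fin 2) k

/-- The field `k(x, y)` of rational functions on `𝔸²` over `k`. -/
abbrev RatFunc (k : Type*) [Field k] := FractionRing (MvPolynomial (Fin 2) k)

/-- The coordinate function `x` (for `i = 0`) or `y` (for `i = 1`), as a rational function. -/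
def coord (k : Type*) [Field k] (i : Fin 2) : RatFunc k :=
  algebraMap (MvPolynomial (Fin 2) k) (RatFunc k) (X i)

/-- A set of points is Zariski dense if its Zariski closure, i.e. the common zero locus of all
the polynomials vanishing on it, is the whole plane. -/
def ZariskiDense {k : Type*} [Field k] (S : Set (Point k)) : Prop :=
  zeroLocus k (vanishingIdeal k S) = Set.univ

/-- A rational function is constant if it is an element of `k`. -/
def IsConstant {k : Type*} [Field k] (g : RatFunc k) : Prop :=
  ∃ c : k, g = algebraMap k (RatFunc k) c

namespace PolyEnd

/-- The self-map `p ↦ (F(p), G(p))` of `𝔸²(k)` induced by `f = (F, G)`. -/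
def toMap {k : Type*} [Field k] (f : PolyEnd k) (p : Point k) : Point k :=
  fun i => eval p (f i)

/-- The forward orbit `{fⁿ(p) | n ≥ 0}`. -/
def orbit {k : Type*} [Field k] (f : PolyEnd k) (p : Point k) : Set (Point k) :=
  Set.range fun n : ℕ => (toMap f)^[n] p

/-- `f` is dominant if its image is Zariski dense. -/
def IsDominant {k : Type*} [Field k] (f : PolyEnd k) : Prop :=
  ZariskiDense (Set.range (toMap f))

/-- Substitution of a dominant `f` into polynomials is injective, so that `f` can be substituted
into rational functions too. -/
theorem IsDominant.injective {k : Type*} [Field k] [Infinite k] {f : PolyEnd k}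
    (hf : IsDominant f) :
    Function.Injective
      ((IsScalarTower.toAlgHom k (MvPolynomial (Fin 2) k) (RatFunc k)).comp (bind₁ f)) := by
  have key : Function.Injective (bind₁ f) := by
    rw [injective_iff_map_eq_zero]
    intro P hP
    refine MvPolynomial.funext fun x => ?_
    have hx : x ∈ zeroLocus k (vanishingIdeal k (Set.range (toMap f))) := by
      rw [show zeroLocus k (vanishingIdeal k (Set.range (toMap f))) = Set.univ from hf]
      trivial
    have hmem : P ∈ vanishingIdeal k (Set.range (toMap f)) := by
      rw [mem_vanishingIdeal_iff]
      rintro _ ⟨y, rfl⟩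
      have h := congrArg (eval y) hP
      rw [map_zero, ← coe_aeval_eq_eval, RingHom.coe_coe, aeval_bind₁] at h
      exact h
    simpa [coe_aeval_eq_eval] using (mem_zeroLocus_iff.mp hx) P hmem
  exact (IsFractionRing.injective (MvPolynomial (Fin 2) k) (RatFunc k)).comp key

/-- The composition `g ∘ f ∈ k(x, y)` of a rational function `g` with a dominant polynomial
endomorphism `f`: the unique extension to `k(x, y)` of the substitution
`P ↦ P(F, G)` on `k[x, y]`. -/
def pullback {k : Type*} [Field k] [Infinite k] (f : PolyEnd k) (hf : IsDominant f) :
    RatFunc k →ₐ[k] RatFunc k :=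
  IsFractionRing.liftAlgHom hf.injective

/-- A dominant polynomial endomorphism `f = (F, G)` is birational if it has a rational inverse:
there is a rational map `h = (h₀, h₁) : 𝔸² ⇢ 𝔸²` with `f ∘ h = id` and `h ∘ f = id`
as rational maps. -/
def IsBirational {k : Type*} [Field k] [Infinite k] (f : PolyEnd k) (hf : IsDominant f) : Prop :=
  ∃ h : Fin 2 → RatFunc k,
    (∀ i, aeval h (f i) = coord k i) ∧ (∀ i, pullback f hf (h i) = coord k i)

end PolyEnd

end AffinePlane

end

open MvPolynomial

noncomputable section

universe u

namespace AffinePlane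

/-! ### Finite fields: points where a polynomial map agrees with Frobenius -/

section

/-! Suppose that only constants are invariant. For a suitable iterate `g` of `f`, a point with dense
`g`-orbit is found from an arithmetic and a geometric input.

Arithmetic (`exists_arithmetic_model`). The map and its inverse are defined over a finitely
generated ring. Over a finite residue field, `f` agrees with a power of Frobenius at some point off
the bad curve of the inverse (`exists_eq_frobenius`). Such a point is periodic with invertible
Jacobian along its orbit; that Jacobian has finite order, so some iterate `g` fixes the point and is
tangent to the identity there. Lifting to characteristic 0, the iterates `g^(p^b)` tend to the
identity on a whole residue disc (`LinOn.iterate_pow_near`). Hence, for an orbit in the disc, the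
set of times at which a polynomial vanishes is `p`-adically closed. The Chinese remainder theorem
achieves this for two primes `p ≠ q` around the same point. The orbit closure is then irreducible
(`isPrime_of_recurrent`): `g` permutes its components, so one of them contains the points at all
multiples of some period, and closedness at both primes extends this to all times. One prime would
not suffice, since it may divide the period.

Geometry (`exists_forall_invariant_dvd`). Only finitely many irreducible curves are invariant. If `P
= 0` is invariant, pullback changes `dlog P` only by an element of a finite-dimensional space
spanned by the `dlog` of contracted curves. Too many such `P` would give three independent invariant
forms, and these would remain independent over `k(x, y)`, where forms have rank 2.

Now take a point of the disc that is not fixed by `g` and lies on no invariant curve. Its orbit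
closure is irreducible; it is neither a point nor a curve, so it is the plane. -/

open MonomialOrder in
theorem degree_X_pow_sub {κ : Type*} [Field κ] {q : ℕ} (i : Fin 2) {F : MvPolynomial (Fin 2) κ}
    (hF : F.totalDegree < q) :
    degLex.degree (X i ^ q - F) = Finsupp.single i q ∧ degLex.Monic (X i ^ q - F) := by
  have h1 : degLex.degree (X i ^ q : MvPolynomial (Fin 2) κ) = Finsupp.single i q := by
    rw [degree_pow, degree_X]; simp
  have h2 : degLex.degree (-F) ≺[degLex] degLex.degree (X i ^ q : MvPolynomial (Fin 2) κ) := by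
    rw [h1, degLex_lt_iff, Finsupp.DegLex.lt_iff]
    left
    simpa [degree_degLexDegree] using hF
  have h3 : degLex.Monic (X i ^ q : MvPolynomial (Fin 2) κ) := Monic.pow (monic_X)
  rw [sub_eq_add_neg]
  exact ⟨by rw [degree_add_of_lt h2, h1], h3.add_of_lt h2⟩

open MonomialOrder in
/-- The ideal `(x ^ q - F, y ^ q - G)`, with `F` and `G` of degree less than `q`, contains no
nonzero polynomial of degree less than `q`. -/
theorem eq_zero_of_mem_span_X_pow_sub {κ : Type*} [Field κ] {q : ℕ}
    {f : Fin 2 → MvPolynomial (Fin 2) κ} (hf : ∀ i, (f i).totalDegree < q)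
    {P : MvPolynomial (Fin 2) κ} (hP : P ∈ Ideal.span (Set.range fun i => X i ^ q - f i))
    (hPq : P.totalDegree < q) : P = 0 := by
  by_contra hP0
  obtain ⟨c, hc⟩ := (Ideal.mem_span_range_iff_exists_fun).1 hP
  rw [Fin.sum_univ_two] at hc
  obtain ⟨d0, m0⟩ := degree_X_pow_sub 0 (hf 0)
  obtain ⟨d1, m1⟩ := degree_X_pow_sub 1 (hf 1)
  set U := X 0 ^ q - f 0
  set V := X 1 ^ q - f 1
  -- Reducing the coefficient of `U` modulo `V` leaves no monomial of `r` divisible by `y ^ q`, so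
  -- the leading terms of `r * U` and `b * V` cannot cancel.
  obtain ⟨a, r, har, -, hr⟩ := degLex.div_single (b := V) (by rw [m1.leadingCoeff_eq_one]; simp) (c 0)
  have hU : U ≠ 0 := m0.ne_zero
  have hV : V ≠ 0 := m1.ne_zero
  set b := c 1 + a * U with hb
  have hPe : P = r * U + b * V := by rw [← hc, har, hb]; ring
  have big : ∀ (s W : MvPolynomial (Fin 2) κ) (i : Fin 2), W ≠ 0 → s ≠ 0 →
      degLex.degree W = Finsupp.single i q → q ≤ (degLex.degree (s * W)).degree := by
    intro s W i hW hs hd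
    rw [degree_mul hs hW, hd]; simp
  have hPd : (degLex.degree P).degree < q := by rwa [degree_degLexDegree]
  by_cases hr0 : r = 0
  · have hb0 : b ≠ 0 := by rintro h; simp [hr0, h] at hPe; exact hP0 hPe
    rw [hPe, hr0, zero_mul, zero_add] at hPd
    exact absurd (big b V 1 hV hb0 d1) (by omega)
  by_cases hb0 : b = 0
  · rw [hPe, hb0, zero_mul, add_zero] at hPd
    exact absurd (big r U 0 hU hr0 d0) (by omega)
  have hne : degLex.degree (r * U) ≠ degLex.degree (b * V) := by
    intro h
    rw [degree_mul hr0 hU, degree_mul hb0 hV, d0, d1] at h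
    refine hr _ (degLex.degree_mem_support hr0) ?_
    rw [d1, Finsupp.single_le_iff]
    have := DFunLike.congr_fun h 1
    simp at this
    omega
  rcases lt_or_gt_of_ne (fun h => hne (degLex.toSyn.injective h)) with h | h
  · have := big b V 1 hV hb0 d1
    rw [← degree_add_eq_right_of_lt h, ← hPe] at this
    omega
  · have := big r U 0 hU hr0 d0
    rw [← degree_add_of_lt h, ← hPe] at this
    omega

-- Division by the two generators, with leading monomials `x ^ q` and `y ^ q`, leaves remainders
-- spanned by the `x ^ a * y ^ b` with `a, b < q`.
open MonomialOrder in
theorem finrank_quotient_span_X_pow_sub_le {κ : Type*} [Field κ] {q : ℕ}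
    {f : Fin 2 → MvPolynomial (Fin 2) κ} (hf : ∀ i, (f i).totalDegree < q) :
    Module.Finite κ (MvPolynomial (Fin 2) κ ⧸ Ideal.span (Set.range fun i => X i ^ q - f i)) ∧
    Module.finrank κ (MvPolynomial (Fin 2) κ ⧸ Ideal.span (Set.range fun i => X i ^ q - f i))
      ≤ q ^ 2 := by
  classical
  set I := Ideal.span (Set.range fun i => X i ^ q - f i)
  let e : Fin q × Fin q → MvPolynomial (Fin 2) κ := fun t => X 0 ^ (t.1 : ℕ) * X 1 ^ (t.2 : ℕ)
  have hspan : (⊤ : Submodule κ (MvPolynomial (Fin 2) κ ⧸ I)) ≤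
      Submodule.span κ (Set.range fun t => Ideal.Quotient.mk I (e t)) := by
    rintro x -
    obtain ⟨P, rfl⟩ := Ideal.Quotient.mk_surjective x
    obtain ⟨c, r, hP, -, hr⟩ := degLex.div (b := fun i => X i ^ q - f i)
      (fun i => by rw [(degree_X_pow_sub i (hf i)).2.leadingCoeff_eq_one]; simp) P
    have hc : Finsupp.linearCombination (MvPolynomial (Fin 2) κ) (fun i => X i ^ q - f i) c ∈ I :=
      (Finsupp.mem_ideal_span_range_iff_exists_finsupp).2 ⟨c, by simp [Finsupp.linearCombination_apply]⟩
    have : Ideal.Quotient.mk I P = Ideal.Quotient.mk I r := by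
      rw [hP, map_add, Ideal.Quotient.eq_zero_iff_mem.2 hc, zero_add]
    rw [this, r.as_sum, map_sum]
    refine Submodule.sum_mem _ fun d hd => ?_
    have h0 : ∀ i, d i < q := fun i => by
      have := hr d hd i
      rw [(degree_X_pow_sub i (hf i)).1, Finsupp.single_le_iff] at this
      omega
    have : monomial d (coeff d r) = coeff d r • e (⟨d 0, h0 0⟩, ⟨d 1, h0 1⟩) := by
      simp [e, monomial_eq, Finsupp.prod_fintype, Algebra.smul_def]
    rw [this]
    change Ideal.Quotient.mkₐ κ I _ ∈ _
    rw [map_smul]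
    exact Submodule.smul_mem _ _ (Submodule.subset_span ⟨_, rfl⟩)
  have hfin : Module.Finite κ (MvPolynomial (Fin 2) κ ⧸ I) :=
    ⟨⟨Finset.univ.image fun t => Ideal.Quotient.mk I (e t), by
      rw [Finset.coe_image, Finset.coe_univ, Set.image_univ]; exact top_le_iff.1 hspan⟩⟩
  refine ⟨hfin, ?_⟩
  rw [← finrank_top]
  calc _ ≤ _ := Submodule.finrank_mono hspan
    _ ≤ _ := finrank_range_le_card _
    _ = q ^ 2 := by simp [sq]

/-- Cayley-Hamilton for multiplication by `x`, whose characteristic polynomial is a power of the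
variable. It bounds the nilpotency exponent by the dimension. -/
theorem pow_finrank_eq_zero_of_isNilpotent {κ A : Type*} [Field κ] [CommRing A] [Algebra κ A]
    [Module.Finite κ A] {x : A} (hx : IsNilpotent x) : x ^ Module.finrank κ A = 0 := by
  have h : IsNilpotent (Algebra.lmul κ A x) := hx.map _
  have h2 := LinearMap.aeval_self_charpoly (Algebra.lmul κ A x)
  rw [LinearMap.charpoly_eq_X_pow_iff _ |>.2 ?_] at h2
  · rw [map_pow, Polynomial.aeval_X, ← map_pow] at h2
    simpa using DFunLike.congr_fun h2 1
  · obtain ⟨n, hn⟩ := h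
    intro m
    exact ⟨n, by rw [hn]; simp⟩

theorem pow_card_pow_eq_bind₁ {κ : Type*} [Field κ] [Fintype κ] (j : ℕ)
    (P : MvPolynomial (Fin 2) κ) :
    P ^ (Fintype.card κ ^ j) = bind₁ (fun i => X i ^ (Fintype.card κ ^ j)) P := by
  obtain ⟨p, hp⟩ := CharP.exists κ
  have := Fact.mk (CharP.char_is_prime κ p)
  obtain ⟨n, -, hn⟩ := FiniteField.card κ p
  rw [hn, ← pow_mul]
  induction P using MvPolynomial.induction_on with
  | C a =>
    rw [← map_pow, bind₁_C_right, pow_mul, ← hn, FiniteField.pow_card_pow]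
  | add P Q hP hQ => rw [map_add, ← hP, ← hQ, add_pow_char_pow]
  | mul_X P i hP => rw [map_mul, mul_pow, hP, bind₁_X_right]

/-- Over a finite field, a polynomial map `f` for which `D ∘ f ∘ f` is nonzero
agrees with a power of Frobenius at some point outside the curve `D = 0`. -/
theorem exists_eq_frobenius {κ L : Type*} [Field κ] [Fintype κ] [Field L] [IsAlgClosed L]
    [Algebra κ L] (f : Fin 2 → MvPolynomial (Fin 2) κ) (D : MvPolynomial (Fin 2) κ)
    (hD : bind₁ f (bind₁ f D) ≠ 0) :
    ∃ (j : ℕ) (z : Fin 2 → L), 1 ≤ j ∧ (∀ i, aeval z (f i) = z i ^ (Fintype.card κ ^ j)) ∧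
      aeval z D ≠ 0 := by
  set c := Fintype.card κ with hc
  have hc1 : 1 < c := Fintype.one_lt_card
  -- Any `j` above these degrees will do, since `j < c ^ j = q`.
  set j := (f 0).totalDegree + (f 1).totalDegree + (bind₁ f (bind₁ f D)).totalDegree + 1 with hj
  have hjq : j < c ^ j := Nat.lt_pow_self hc1
  set q := c ^ j with hq
  have hf : ∀ i, (f i).totalDegree < q := by
    intro i; fin_cases i <;> simp <;> omega
  refine ⟨j, ?_⟩
  by_contra! hcon
  set I := Ideal.span (Set.range fun i => X i ^ q - f i) with hI
  have hrad : D ∈ I.radical := by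
    rw [← vanishingIdeal_zeroLocus_eq_radical (K := L), mem_vanishingIdeal_iff]
    intro z hz
    refine hcon z (by omega) fun i => ?_
    have := hz _ (Ideal.subset_span ⟨i, rfl⟩)
    rw [map_sub, map_pow, aeval_X, sub_eq_zero] at this
    exact this.symm
  obtain ⟨hfin, hrank⟩ := finrank_quotient_span_X_pow_sub_le hf
  have hnil : IsNilpotent (Ideal.Quotient.mk I D) := by
    obtain ⟨n, hn⟩ := hrad
    exact ⟨n, by rw [← map_pow]; exact Ideal.Quotient.eq_zero_iff_mem.2 hn⟩
  have hmem : Ideal.Quotient.mk I D ^ (q ^ 2) = 0 :=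
    pow_eq_zero_of_le hrank (pow_finrank_eq_zero_of_isNilpotent hnil)
  -- Modulo `I` the `q`-th power map is composition with `f`. The exponent `q ^ 2` therefore amounts
  -- to composing twice, and `D ∘ f ∘ f` lands in `I` with degree less than `q`.
  have key : ∀ P : MvPolynomial (Fin 2) κ,
      Ideal.Quotient.mk I P ^ q = Ideal.Quotient.mk I (bind₁ f P) := by
    intro P
    rw [← map_pow, hq, pow_card_pow_eq_bind₁]
    have : (Ideal.Quotient.mkₐ κ I).comp (bind₁ fun i => X i ^ q) =
        (Ideal.Quotient.mkₐ κ I).comp (bind₁ f) := by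
      ext i
      simp only [AlgHom.comp_apply, bind₁_X_right]
      exact Ideal.Quotient.eq.2 (Ideal.subset_span ⟨i, rfl⟩)
    exact DFunLike.congr_fun this P
  rw [sq, pow_mul, key, key, Ideal.Quotient.eq_zero_iff_mem] at hmem
  exact hD (eq_zero_of_mem_span_X_pow_sub hf hmem (by omega))

/-- Over a finite field, a polynomial map `f` for which `D ∘ f ∘ f` is nonzero has a periodic
point whose orbit avoids the curve `D = 0`. -/
theorem exists_periodic_avoiding {κ L : Type*} [Field κ] [Finite κ] [Field L] [IsAlgClosed L]
    [Algebra κ L] [Algebra.IsAlgebraic κ L] (f : Fin 2 → MvPolynomial (Fin 2) κ)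
    (D : MvPolynomial (Fin 2) κ) (hD : bind₁ f (bind₁ f D) ≠ 0) :
    ∃ (N : ℕ) (z : Fin 2 → L), 1 ≤ N ∧ (fun x i => aeval x (f i))^[N] z = z ∧
      ∀ n, aeval ((fun x i => aeval x (f i))^[n] z) D ≠ 0 := by
  have := Fintype.ofFinite κ
  obtain ⟨j, z, hj, hz, hzD⟩ := exists_eq_frobenius (L := L) f D hD
  set c := Fintype.card κ with hc
  have frob : ∀ (n : ℕ) (P : MvPolynomial (Fin 2) κ) (x : Fin 2 → L),
      aeval (fun i => x i ^ c ^ n) P = aeval x P ^ c ^ n := by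
    intro n P x
    rw [← map_pow, pow_card_pow_eq_bind₁, aeval_bind₁]
    simp [hc]
  -- `f` has coefficients in `κ`, so it commutes with Frobenius and its whole orbit through `z`
  -- consists of Frobenius conjugates of `z`.
  have iter : ∀ n, (fun x i => aeval x (f i))^[n] z = fun i => z i ^ c ^ (j * n) := by
    intro n
    induction n with
    | zero => simp
    | succ n ih =>
      rw [Function.iterate_succ_apply', ih]
      funext i
      rw [frob, hz, ← pow_mul, ← pow_add]
      congr 2; ring
  have hfix : ∀ a : L, ∃ m, 1 ≤ m ∧ a ^ c ^ m = a := by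
    intro a
    have ha : IsIntegral κ a := (Algebra.IsAlgebraic.isAlgebraic a).isIntegral
    have := IntermediateField.adjoin.finiteDimensional ha
    have : Finite (IntermediateField.adjoin κ {a}) := Module.finite_of_finite κ
    have := Fintype.ofFinite (IntermediateField.adjoin κ {a})
    refine ⟨Module.finrank κ (IntermediateField.adjoin κ {a}), Module.finrank_pos, ?_⟩
    have := FiniteField.pow_card (⟨a, IntermediateField.mem_adjoin_simple_self κ a⟩ :
      IntermediateField.adjoin κ {a})
    rw [Module.card_eq_pow_finrank (K := κ)] at this
    exact congrArg Subtype.val this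
  have hmul : ∀ (a : L) (m t : ℕ), a ^ c ^ m = a → a ^ c ^ (m * t) = a := by
    intro a m t h
    induction t with
    | zero => simp
    | succ t ih => rw [mul_add, mul_one, pow_add, pow_mul, ih, h]
  obtain ⟨m0, hm0, h0⟩ := hfix (z 0)
  obtain ⟨m1, hm1, h1⟩ := hfix (z 1)
  refine ⟨m0 * m1, z, Nat.mul_pos hm0 hm1, ?_, fun n => ?_⟩
  · rw [iter]
    funext i
    fin_cases i
    · simpa [show j * (m0 * m1) = m0 * (m1 * j) by ring] using hmul _ _ _ h0
    · simpa [show j * (m0 * m1) = m1 * (m0 * j) by ring] using hmul _ _ _ h1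
  · rw [iter, frob]
    exact pow_ne_zero _ hzD

end

/-! ### Adic approximation of polynomial maps by linear maps -/

section

/-- The self-map of `A²` given by a pair of polynomials over a commutative ring `A`. -/
def polyMap {A : Type*} [CommRing A] (f : Fin 2 → MvPolynomial (Fin 2) A) (x : Fin 2 → A) :
    Fin 2 → A :=
  fun i => eval x (f i)

/-- Coordinatewise congruence of two points modulo an ideal. -/
def Near {A : Type*} [CommRing A] (I : Ideal A) (x y : Fin 2 → A) : Prop :=
  ∀ i, x i - y i ∈ I

section Near
variable {A : Type*} [CommRing A] {I : Ideal A}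

theorem Near.refl (x : Fin 2 → A) : Near I x x := fun i => by simp

theorem Near.symm {x y : Fin 2 → A} (h : Near I x y) : Near I y x := fun i => by
  rw [← neg_sub]; exact I.neg_mem (h i)

theorem Near.trans {x y z : Fin 2 → A} (h : Near I x y) (h' : Near I y z) : Near I x z := fun i => by
  rw [← sub_add_sub_cancel]; exact I.add_mem (h i) (h' i)

theorem Near.mono {J : Ideal A} (hIJ : I ≤ J) {x y : Fin 2 → A} (h : Near I x y) : Near J x y :=
  fun i => hIJ (h i)

theorem Near.eval {x y : Fin 2 → A} (h : Near I x y) (P : MvPolynomial (Fin 2) A) :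
    eval x P - eval y P ∈ I := by
  induction P using MvPolynomial.induction_on with
  | C a => simp
  | add P Q hP hQ =>
    rw [map_add, map_add, add_sub_add_comm]; exact I.add_mem hP hQ
  | mul_X P i hP =>
    rw [map_mul, map_mul, eval_X, eval_X, mul_sub_mul_comm']
    exact I.add_mem (I.mul_mem_right _ hP) (I.mul_mem_left _ (h i))
  where mul_sub_mul_comm' {a b c d : A} : a * b - c * d = (a - c) * b + c * (b - d) := by ring

theorem taylor_mem (x : Fin 2 → A) {u : Fin 2 → A} (hu : ∀ i, u i ∈ I)
    (P : MvPolynomial (Fin 2) A) :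
    eval (x + u) P - eval x P - ∑ j, eval x (pderiv j P) * u j ∈ I ^ 2 := by
  induction P using MvPolynomial.induction_on with
  | C a => simp
  | add P Q hP hQ =>
    convert! (I ^ 2).add_mem hP hQ using 1
    simp only [map_add, Fin.sum_univ_two]; ring
  | mul_X P i hP =>
    have h1 : eval (x + u) P - eval x P ∈ I := Near.eval (fun i => by simpa using hu i) P
    have h2 : (eval (x + u) P - eval x P) * u i ∈ I ^ 2 := by
      rw [sq]; exact Ideal.mul_mem_mul h1 (hu i)
    convert! (I ^ 2).add_mem ((I ^ 2).mul_mem_right (x i) hP) h2 using 1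
    fin_cases i <;> simp [Fin.sum_univ_two, pderiv_X] <;> ring

/-- On points congruent to `a` modulo `I`, the map `g` takes values congruent to `b`, and
it is approximated `I`-adically by the linear map `D`. -/
structure LinOn (I : Ideal A) (g : (Fin 2 → A) → Fin 2 → A) (a b : Fin 2 → A)
    (D : Matrix (Fin 2) (Fin 2) A) : Prop where
  maps : ∀ x, Near I x a → Near I (g x) b
  lin : ∀ x, Near I x a → ∀ s, 1 ≤ s → ∀ u : Fin 2 → A, (∀ i, u i ∈ I ^ s) →
    Near (I ^ (s + 1)) (g (x + u)) (g x + D.mulVec u)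

theorem mulVec_mem {J : Ideal A} (D : Matrix (Fin 2) (Fin 2) A) {u : Fin 2 → A}
    (hu : ∀ i, u i ∈ J) (i : Fin 2) : D.mulVec u i ∈ J := by
  change ∑ j, D i j * u j ∈ J
  exact J.sum_mem fun j _ => J.mul_mem_left _ (hu j)

theorem LinOn.comp {g h : (Fin 2 → A) → Fin 2 → A} {a b c : Fin 2 → A}
    {D E : Matrix (Fin 2) (Fin 2) A} (hh : LinOn I h b c E) (hg : LinOn I g a b D) :
    LinOn I (h ∘ g) a c (E * D) := by
  refine ⟨fun x hx => hh.maps _ (hg.maps _ hx), fun x hx s hs u hu => ?_⟩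
  have h1 := hg.lin x hx s hs u hu
  set v := g (x + u) - g x with hv
  have hvD : ∀ i, v i - D.mulVec u i ∈ I ^ (s + 1) := fun i => by
    have := h1 i
    simpa [hv, sub_sub] using this
  have hvs : ∀ i, v i ∈ I ^ s := fun i => by
    rw [← sub_add_cancel (v i) (D.mulVec u i)]
    exact (I ^ s).add_mem (Ideal.pow_le_pow_right (Nat.le_succ s) (hvD i)) (mulVec_mem D hu i)
  have h2 := hh.lin (g x) (hg.maps x hx) s hs v hvs
  have h3 := mulVec_mem E (u := v - D.mulVec u) hvD
  intro i
  have h4 := (I ^ (s + 1)).add_mem (h2 i) (h3 i)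
  have e1 : g x + v = g (x + u) := by rw [hv]; abel
  rw [e1] at h4
  convert! h4 using 1
  rw [Matrix.mulVec_sub E v, Matrix.mulVec_mulVec]
  simp only [Function.comp_apply, Pi.add_apply, Pi.sub_apply]
  ring

theorem LinOn.id (a : Fin 2 → A) : LinOn I id a a 1 :=
  ⟨fun x hx => hx, fun x _ s _ u _ => by simpa using Near.refl _⟩

theorem LinOn.iterate {g : (Fin 2 → A) → Fin 2 → A} {a : Fin 2 → A}
    {D : Matrix (Fin 2) (Fin 2) A} (hg : LinOn I g a a D) (n : ℕ) :
    LinOn I g^[n] a a (D ^ n) := by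
  induction n with
  | zero => simpa using LinOn.id a
  | succ n ih => rw [Function.iterate_succ, pow_succ]; exact ih.comp hg

theorem LinOn.congr_right {g : (Fin 2 → A) → Fin 2 → A} {a b b' : Fin 2 → A}
    {D : Matrix (Fin 2) (Fin 2) A} (hg : LinOn I g a b D) (h : Near I b b') :
    LinOn I g a b' D :=
  ⟨fun x hx => (hg.maps x hx).trans h, hg.lin⟩

/-- Only `D` modulo `I` matters: an error in `I` applied to `u ∈ I ^ s` falls in `I ^ (s + 1)`. -/
theorem LinOn.congr_matrix {g : (Fin 2 → A) → Fin 2 → A} {a b : Fin 2 → A}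
    {D D' : Matrix (Fin 2) (Fin 2) A} (hg : LinOn I g a b D) (h : ∀ i j, D i j - D' i j ∈ I) :
    LinOn I g a b D' := by
  refine ⟨hg.maps, fun x hx s hs u hu i => ?_⟩
  have h1 := hg.lin x hx s hs u hu i
  have h2 : (D - D').mulVec u i ∈ I ^ (s + 1) := by
    change ∑ j, (D i j - D' i j) * u j ∈ _
    rw [pow_succ']
    exact Ideal.sum_mem _ fun j _ => Ideal.mul_mem_mul (h i j) (hu j)
  convert! (I ^ (s + 1)).add_mem h1 h2 using 1
  rw [Matrix.sub_mulVec]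
  simp only [Pi.add_apply, Pi.sub_apply]
  ring

/-- The Jacobian matrix of a pair of polynomials at a point. -/
def jacobianAt (f : Fin 2 → MvPolynomial (Fin 2) A) (a : Fin 2 → A) : Matrix (Fin 2) (Fin 2) A :=
  Matrix.of fun i j => eval a (pderiv j (f i))

theorem linOn_polyMap (I : Ideal A) (f : Fin 2 → MvPolynomial (Fin 2) A) (a : Fin 2 → A) :
    LinOn I (polyMap f) a (polyMap f a) (jacobianAt f a) := by
  refine ⟨fun x hx i => hx.eval _, fun x hx s hs u hu i => ?_⟩
  have h1 : eval (x + u) (f i) - eval x (f i) - ∑ j, eval x (pderiv j (f i)) * u j ∈ I ^ (s + 1) := by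
    have := taylor_mem x hu (f i)
    rw [← pow_mul] at this
    -- The quadratic error lies in `I ^ (2 * s)`, and `2 * s ≥ s + 1` because `s ≥ 1`.
    exact Ideal.pow_le_pow_right (by omega) this
  have h2 : ∑ j, (eval x (pderiv j (f i)) - eval a (pderiv j (f i))) * u j ∈ I ^ (s + 1) := by
    rw [pow_succ']
    exact Ideal.sum_mem _ fun j _ => Ideal.mul_mem_mul (hx.eval _) (hu j)
  convert! (I ^ (s + 1)).add_mem h1 h2 using 1
  change eval (x + u) (f i) - (eval x (f i) + ∑ j, eval a (pderiv j (f i)) * u j) = _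
  simp only [Fin.sum_univ_two]; ring

/-- If `g` is tangent to the identity modulo `I`, its `p`-power iterates converge to the identity
`I`-adically. -/
theorem LinOn.iterate_pow_near {g : (Fin 2 → A) → Fin 2 → A} {a : Fin 2 → A}
    (hg : LinOn I g a a 1) {p : ℕ} (hp : (p : A) ∈ I) (b : ℕ) :
    ∀ x, Near I x a → Near (I ^ (b + 1)) (g^[p ^ b] x) x := by
  induction b with
  | zero =>
    intro x hx
    simpa using (hg.maps x hx).trans hx.symm
  | succ b ih =>
    intro x hx
    set h := g^[p ^ b] with hh
    have hl : LinOn I h a a 1 := by simpa using hg.iterate (p ^ b)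
    have hmem : ∀ n, Near I (h^[n] x) a := fun n => by
      have := (hl.iterate n).maps x hx
      simpa using this
    -- Modulo `I ^ (b + 2)` each application of `h` translates by the same `ε`, so `h^[p]`
    -- translates by `p • ε`, and the factor `p ∈ I` gains one power of `I`.
    set ε := h x - x with hε
    have hεs : ∀ i, ε i ∈ I ^ (b + 1) := ih x hx
    have step : ∀ n, Near (I ^ (b + 2)) (h^[n + 1] x) (h^[n] x + ε) := by
      intro n
      induction n with
      | zero => simpa [hε] using Near.refl (h x)
      | succ n ihn =>
        set v := h^[n + 1] x - h^[n] x with hv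
        have hvε : ∀ i, v i - ε i ∈ I ^ (b + 2) := fun i => by
          have := ihn i
          simpa [hv, sub_sub] using this
        have hvs : ∀ i, v i ∈ I ^ (b + 1) := fun i => by
          have := (I ^ (b + 1)).add_mem
            (Ideal.pow_le_pow_right (Nat.le_succ _) (hvε i)) (hεs i)
          simpa using this
        have h1 := hl.lin _ (hmem n) (b + 1) (by omega) v hvs
        rw [Matrix.one_mulVec] at h1
        have e1 : h^[n] x + v = h^[n + 1] x := by rw [hv]; abel
        rw [e1, ← Function.iterate_succ_apply' h, ← Function.iterate_succ_apply' h] at h1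
        intro i
        convert! (I ^ (b + 2)).add_mem (h1 i) (hvε i) using 1
        simp only [Pi.add_apply]; ring
    have sum : ∀ n : ℕ, Near (I ^ (b + 2)) (h^[n] x) (x + (n : A) • ε) := by
      intro n
      induction n with
      | zero => simpa using Near.refl x
      | succ n ihn =>
        intro i
        have := (I ^ (b + 2)).add_mem (step n i) (ihn i)
        convert! this using 1
        simp; ring
    have hfin : Near (I ^ (b + 2)) (x + (p : A) • ε) x := fun i => by
      simp only [Pi.add_apply, Pi.smul_apply, smul_eq_mul, add_sub_cancel_left]
      rw [pow_succ' I]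
      exact Ideal.mul_mem_mul hp (hεs i)
    have := (sum p).trans hfin
    rwa [hh, ← Function.iterate_mul, ← pow_succ] at this

end Near

end

/-! ### Recurrent sequences of points and irreducibility of their closure -/

section

/-- A polynomial over `k` that vanishes at `A`-points arbitrarily `I`-adically close to `w`
vanishes at `w`. -/
theorem eval_eq_zero_of_near {A k : Type*} [CommRing A] [IsDomain A] [IsNoetherianRing A] [Field k]
    [Algebra A k] [FaithfulSMul A k] {I : Ideal A} (hI : I ≠ ⊤) (w : Fin 2 → A)
    (P : MvPolynomial (Fin 2) k)
    (h : ∀ s : ℕ, ∃ v, Near (I ^ s) v w ∧ eval (fun i => algebraMap A k (v i)) P = 0) :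
    eval (fun i => algebraMap A k (w i)) P = 0 := by
  let : Algebra (FractionRing A) k := FractionRing.liftAlgebra A k
  have : IsScalarTower A (FractionRing A) k := FractionRing.isScalarTower_liftAlgebra A k
  -- The coefficients of `P` lie in `k`, not in `A`. A linear functional on `k` over the fraction
  -- field brings them down, and clearing denominators gives `Q` over `A`, to which Krull's
  -- intersection theorem applies.
  rw [← Module.forall_dual_apply_eq_zero_iff (FractionRing A)]
  intro l
  obtain ⟨b, hb⟩ := IsLocalization.exist_integer_multiples (nonZeroDivisors A) P.support
    (fun d => l (coeff d P))
  choose! c hc using hb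
  set Q : MvPolynomial (Fin 2) A := ∑ d ∈ P.support, monomial d (c d) with hQ
  have key : ∀ v : Fin 2 → A, algebraMap A (FractionRing A) (eval v Q) =
      (b : A) • l (eval (fun i => algebraMap A k (v i)) P) := by
    intro v
    rw [hQ, eval_eq (fun i => algebraMap A k (v i)), map_sum, map_sum, map_sum, Finset.smul_sum]
    refine Finset.sum_congr rfl fun d hd => ?_
    have e : coeff d P * ∏ i ∈ d.support, algebraMap A k (v i) ^ d i =
        algebraMap A (FractionRing A) (∏ i ∈ d.support, v i ^ d i) • coeff d P := by
      rw [Algebra.smul_def, ← IsScalarTower.algebraMap_apply, map_prod, mul_comm]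
      simp
    rw [e, map_smul, eval_monomial, map_mul, hc d hd, smul_eq_mul, mul_comm, mul_smul_comm]
    rfl
  have hz : eval w Q = 0 := by
    have : eval w Q ∈ (⨅ s, I ^ s : Ideal A) := by
      rw [Ideal.mem_iInf]
      intro s
      obtain ⟨v, hv, hv0⟩ := h s
      have h0 : eval v Q = 0 := by
        apply IsFractionRing.injective A (FractionRing A)
        rw [key, hv0, map_zero, map_zero, smul_zero]
      simpa [h0] using hv.symm.eval Q
    rwa [Ideal.iInf_pow_eq_bot_of_isDomain I hI, Ideal.mem_bot] at this
  have := key w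
  rw [hz, map_zero] at this
  exact (smul_eq_zero_iff_right (nonZeroDivisors.coe_ne_zero b)).1 this.symm

theorem exists_dvd_add_mul {c m : ℕ} (h : c.Coprime m) (hm : 0 < m) (n : ℕ) :
    ∃ t, m ∣ n + c * t := by
  obtain ⟨x, hx⟩ := Nat.chineseRemainder h 0 ((m - 1) * n)
  obtain ⟨t, rfl⟩ := (Nat.modEq_zero_iff_dvd).1 hx.1
  refine ⟨t, (Nat.modEq_zero_iff_dvd).1 ?_⟩
  calc n + c * t ≡ n + (m - 1) * n [MOD m] := Nat.ModEq.add_left _ hx.2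
    _ = m * n := by obtain ⟨m, rfl⟩ := Nat.exists_eq_add_of_lt hm; simp; ring
    _ ≡ 0 [MOD m] := (Nat.modEq_zero_iff_dvd).2 ⟨n, rfl⟩

/-- If a set of natural numbers is closed under limits for both the `p`-adic and the
`q`-adic topologies, and contains the multiples of some positive `M`, then it is everything. -/
theorem forall_of_forall_mul {Z : ℕ → Prop} {p q : ℕ} (hp : p.Prime) (hq : q.Prime) (hpq : p ≠ q)
    (hZp : ∀ n, (∀ b, ∃ t, Z (n + p ^ b * t)) → Z n)
    (hZq : ∀ n, (∀ b, ∃ t, Z (n + q ^ b * t)) → Z n)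
    {M : ℕ} (hM : 0 < M) (hZ : ∀ n, Z (M * n)) (n : ℕ) : Z n := by
  -- The multiples of `p ^ a * m` are `p`-adically dense in those of `p ^ a`, which are in turn
  -- `q`-adically dense in `ℕ`.
  obtain ⟨a, m, hm, rfl⟩ := Nat.exists_eq_pow_mul_and_not_dvd hM.ne' p hp.ne_one
  have hm0 : 0 < m := Nat.pos_of_mul_pos_left hM
  have h1 : ∀ n, Z (p ^ a * n) := by
    refine fun n => hZp _ fun b => ?_
    have hco : (p ^ b).Coprime m := Nat.Coprime.pow_left _ ((Nat.Prime.coprime_iff_not_dvd hp).2 hm)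
    obtain ⟨t, u, hu⟩ := exists_dvd_add_mul hco hm0 n
    refine ⟨p ^ a * t, ?_⟩
    have : p ^ a * n + p ^ b * (p ^ a * t) = p ^ a * m * u := by
      rw [mul_assoc, ← hu]; ring
    rw [this]
    exact hZ u
  refine hZq n fun b => ?_
  have hco : (q ^ b).Coprime (p ^ a) := Nat.Coprime.pow _ _ ((Nat.coprime_primes hq hp).2 hpq.symm)
  obtain ⟨t, u, hu⟩ := exists_dvd_add_mul hco (Nat.pow_pos hp.pos) n
  exact ⟨t, by rw [hu]; exact h1 u⟩

/-- Let `I` be the ideal of polynomials vanishing along a sequence `w` on which `φ` acts as the shift.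
If vanishing along a tail or along the multiples of some `M` implies
vanishing along the whole sequence, then `I` is prime. -/
theorem isPrime_of_recurrent {S k : Type*} [CommRing S] [IsNoetherianRing S] [Field k]
    (φ : S →+* S) (ev : ℕ → S →+* k) (hev : ∀ n, ev (n + 1) = (ev n).comp φ)
    (htail : ∀ P, (∀ n, ev (n + 1) P = 0) → ev 0 P = 0)
    (hmul : ∀ P, ∀ M, 0 < M → (∀ n, ev (M * n) P = 0) → ∀ n, ev n P = 0) :
    (⨅ n, RingHom.ker (ev n)).IsPrime := by
  set I : Ideal S := ⨅ n, RingHom.ker (ev n) with hI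
  have memI : ∀ P, P ∈ I ↔ ∀ n, ev n P = 0 := fun P => by
    simp [hI, RingHom.mem_ker]
  have hcomap : I.comap φ = I := by
    ext P
    rw [Ideal.mem_comap, memI, memI]
    have e : ∀ n, ev n (φ P) = ev (n + 1) P := fun n => by rw [hev]; rfl
    simp only [e]
    exact ⟨fun h n => Nat.casesOn n (htail P h) h, fun h n => h _⟩
  have hrad : I.IsRadical := by
    rintro P ⟨m, hm⟩
    rw [memI] at hm ⊢
    intro n
    have := hm n
    rw [map_pow] at this
    exact eq_zero_of_pow_eq_zero this
  have hfin := I.finite_minimalPrimes_of_isNoetherianRing S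
  -- `I` is the preimage of the intersection of its minimal primes, so each minimal prime contains,
  -- hence equals, the preimage of one of them. The resulting `σ` is an injection of a finite set,
  -- so all its points are periodic.
  have hex : ∀ p : I.minimalPrimes, ∃ q : I.minimalPrimes, q.1.comap φ = p.1 := by
    rintro ⟨p, hp⟩
    have hpp : p.IsPrime := hp.1.1
    have hle : hfin.toFinset.inf (fun q => q.comap φ) ≤ p := by
      refine (le_trans ?_ hcomap.le).trans hp.1.2
      intro x hx
      rw [Ideal.mem_comap]
      have : φ x ∈ sInf I.minimalPrimes := by
        rw [Ideal.mem_sInf]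
        intro q hq
        have := (Finset.inf_le (f := fun q : Ideal S => q.comap φ) (hfin.mem_toFinset.2 hq)) hx
        exact this
      rwa [Ideal.sInf_minimalPrimes, hrad.radical] at this
    obtain ⟨q, hq, hqp⟩ := (Ideal.IsPrime.inf_le' hpp).1 hle
    have hq' := hfin.mem_toFinset.1 hq
    have hqprime : q.IsPrime := hq'.1.1
    refine ⟨⟨q, hq'⟩, le_antisymm hqp (hp.2 ⟨inferInstance, ?_⟩ hqp)⟩
    exact hcomap.ge.trans (Ideal.comap_mono hq'.1.2)
  choose σ hσ using hex
  have hσi : Function.Injective σ := fun p q h => Subtype.ext (by rw [← hσ p, ← hσ q, h])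
  have := hfin.to_subtype
  have hker : I ≤ RingHom.ker (ev 0) := iInf_le _ 0
  have hkerp : (RingHom.ker (ev 0)).IsPrime := RingHom.ker_isPrime _
  obtain ⟨p, hp, hpk⟩ := Ideal.exists_minimalPrimes_le hker
  obtain ⟨M, hM, hper⟩ := hσi.mem_periodicPts ⟨p, hp⟩
  have hiter : ∀ n (r : I.minimalPrimes), ((σ^[n] r).1).comap (φ ^ n) = r.1 := by
    intro n
    induction n with
    | zero => intro r; exact Ideal.comap_id _
    | succ n ih =>
      intro r
      rw [Function.iterate_succ_apply, pow_succ]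
      change Ideal.comap ((φ ^ n).comp φ) _ = _
      rw [← Ideal.comap_comap, ih, hσ]
  have hevp : ∀ n, ev n = (ev 0).comp (φ ^ n) := by
    intro n
    induction n with
    | zero => rfl
    | succ n ih => rw [hev, ih, pow_succ]; rfl
  suffices p = I by rw [← this]; exact hp.1.1
  -- With `M` the period of `p`, an element of `p` stays in `p ≤ ker (ev 0)` under every `φ ^ (M *
  -- n)`, so it vanishes at all multiples of `M`.
  refine le_antisymm (fun P hP => (memI P).2 (hmul P M hM fun n => ?_)) hp.1.2
  rw [hevp]
  refine hpk ?_
  have hpn : σ^[M * n] ⟨p, hp⟩ = ⟨p, hp⟩ := hper.mul_const n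
  have := hiter (M * n) ⟨p, hp⟩
  rw [hpn] at this
  rw [← Ideal.mem_comap, this]
  exact hP

end

/-! ### Logarithmic differentials and pullback of forms -/

section

section ChainRule
variable {A : Type*} [CommRing A]

theorem pderiv_bind₁ (g : Fin 2 → MvPolynomial (Fin 2) A) (j : Fin 2)
    (P : MvPolynomial (Fin 2) A) :
    pderiv j (bind₁ g P) = ∑ i, bind₁ g (pderiv i P) * pderiv j (g i) := by
  induction P using MvPolynomial.induction_on with
  | C a => simp
  | add P Q hP hQ => simp only [map_add, hP, hQ, add_mul, Finset.sum_add_distrib]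
  | mul_X P l hP =>
    rw [map_mul, pderiv_mul, hP]
    simp only [pderiv_mul, map_add, map_mul, bind₁_X_right, add_mul, Finset.sum_add_distrib,
      Finset.sum_mul]
    congr 1
    · exact Finset.sum_congr rfl fun i _ => by ring
    · fin_cases l <;> simp [Fin.sum_univ_two, pderiv_X]

theorem totalDegree_pderiv_lt {P : MvPolynomial (Fin 2) A} {j : Fin 2} (h : pderiv j P ≠ 0) :
    (pderiv j P).totalDegree < P.totalDegree := by
  obtain ⟨m, hm, hmd⟩ : ∃ m ∈ (pderiv j P).support, m.degree = (pderiv j P).totalDegree := by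
    obtain ⟨m, hm, h2⟩ := Finset.exists_mem_eq_sup (pderiv j P).support
      (Finset.nonempty_iff_ne_empty.2 (by simpa using h)) fun s => s.degree
    exact ⟨m, hm, h2.symm⟩
  rw [mem_support_iff, coeff_pderiv] at hm
  have : m + Finsupp.single j 1 ∈ P.support := mem_support_iff.2 (left_ne_zero_of_mul hm)
  have h3 := le_totalDegree this
  change (m + Finsupp.single j 1).degree ≤ _ at h3
  rw [map_add, Finsupp.degree_single] at h3
  omega

end ChainRule

variable {k : Type*} [Field k]

/-- Derivatives have smaller degree, so divisibility would make both vanish, and in characteristic 0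
`P` would be constant. -/
theorem exists_not_dvd_pderiv [CharZero k] {P : MvPolynomial (Fin 2) k} (hP : Irreducible P) :
    ∃ j, ¬ P ∣ pderiv j P := by
  by_contra! h
  have h0 : ∀ j, pderiv j P = 0 := by
    intro j
    by_contra hj
    have h1 := totalDegree_le_of_dvd_of_isDomain (h j) hj
    have h2 := totalDegree_pderiv_lt hj
    omega
  have hsupp : ∀ m, m ≠ 0 → coeff m P = 0 := by
    intro m hm
    obtain ⟨i, hi⟩ := Finsupp.ne_iff.1 hm
    have h1 := congrArg (coeff (m - Finsupp.single i 1)) (h0 i)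
    rw [coeff_pderiv, tsub_add_cancel_of_le (Finsupp.single_le_iff.2 (Nat.one_le_iff_ne_zero.2 hi)),
      coeff_zero] at h1
    exact (mul_eq_zero.1 h1).resolve_right (Nat.cast_add_one_ne_zero _)
  have hC : P = C (coeff 0 P) := by
    ext m
    rw [coeff_C]
    split_ifs with hm
    · rw [hm]
    · exact hsupp m (Ne.symm hm)
  have hne : coeff 0 P ≠ 0 := by
    intro h
    rw [h, map_zero] at hC
    exact hP.ne_zero hC
  exact hP.not_isUnit (hC ▸ (isUnit_iff_ne_zero.2 hne).map C)

/-- The gradient of a polynomial, as a vector of rational functions. -/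
def grad (P : MvPolynomial (Fin 2) k) : Fin 2 → RatFunc k :=
  fun j => algebraMap _ (RatFunc k) (pderiv j P)

/-- The logarithmic differential `dP / P`. -/
def dlog (P : MvPolynomial (Fin 2) k) : Fin 2 → RatFunc k :=
  (algebraMap _ (RatFunc k) P)⁻¹ • grad P

theorem algebraMap_ne_zero {P : MvPolynomial (Fin 2) k} (hP : P ≠ 0) :
    algebraMap _ (RatFunc k) P ≠ 0 :=
  fun h => hP (IsFractionRing.injective (MvPolynomial (Fin 2) k) (RatFunc k) (by simpa using h))

theorem dlog_mul {P Q : MvPolynomial (Fin 2) k} (hP : P ≠ 0) (hQ : Q ≠ 0) :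
    dlog (P * Q) = dlog P + dlog Q := by
  have := algebraMap_ne_zero hP
  have := algebraMap_ne_zero hQ
  funext j
  simp only [dlog, grad, Pi.smul_apply, Pi.add_apply, pderiv_mul, map_mul, map_add, smul_eq_mul]
  field_simp

theorem dlog_of_isUnit {P : MvPolynomial (Fin 2) k} (hP : IsUnit P) : dlog P = 0 := by
  obtain ⟨c, -, rfl⟩ := MvPolynomial.isUnit_iff_eq_C_of_isReduced.1 hP
  funext j
  simp [dlog, grad]

/-- The logarithmic differentials of pairwise non-associated irreducible polynomials are linearly
independent over the constants. -/
theorem linearIndependent_dlog [CharZero k] {n : ℕ} {P : Fin n → MvPolynomial (Fin 2) k}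
    (hP : ∀ i, Irreducible (P i)) (hne : ∀ i j, i ≠ j → ¬ P i ∣ P j) :
    LinearIndependent k fun i => dlog (P i) := by
  classical
  rw [Fintype.linearIndependent_iff]
  intro c hc i
  by_contra hci
  obtain ⟨l, hl⟩ := exists_not_dvd_pderiv (hP i)
  have hPi : Prime (P i) := (hP i).prime
  -- The relation with denominators cleared; modulo `P i` only the term of index `i` survives.
  have hsum : ∑ m, C (c m) * (∏ j ∈ Finset.univ.erase m, P j) * pderiv l (P m) = 0 := by
    apply IsFractionRing.injective (MvPolynomial (Fin 2) k) (RatFunc k)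
    rw [map_sum, map_zero]
    have h1 := congrArg (fun v => algebraMap _ (RatFunc k) (∏ j, P j) * v l) hc
    simp only [Finset.sum_apply, Pi.smul_apply, Pi.zero_apply, mul_zero, Finset.mul_sum] at h1
    rw [← h1]
    refine Finset.sum_congr rfl fun m _ => ?_
    rw [← Finset.mul_prod_erase _ _ (Finset.mem_univ m)]
    have := algebraMap_ne_zero (hP m).ne_zero
    rw [map_mul, map_mul, map_mul, Algebra.smul_def]
    have e : algebraMap (MvPolynomial (Fin 2) k) (RatFunc k) (C (c m)) =
        algebraMap k (RatFunc k) (c m) :=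
      (IsScalarTower.algebraMap_apply k (MvPolynomial (Fin 2) k) (RatFunc k) (c m)).symm
    rw [e]
    simp only [dlog, grad, Pi.smul_apply, smul_eq_mul]
    field_simp
  rw [← Finset.add_sum_erase _ _ (Finset.mem_univ i)] at hsum
  have hrest : P i ∣ ∑ m ∈ Finset.univ.erase i,
      C (c m) * (∏ j ∈ Finset.univ.erase m, P j) * pderiv l (P m) := by
    refine Finset.dvd_sum fun m hm => ?_
    refine Dvd.dvd.mul_right (Dvd.dvd.mul_left (Finset.dvd_prod_of_mem _ ?_) _) _
    exact Finset.mem_erase.2 ⟨(Finset.ne_of_mem_erase hm).symm, Finset.mem_univ _⟩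
  have hmain : P i ∣ C (c i) * (∏ j ∈ Finset.univ.erase i, P j) * pderiv l (P i) := by
    rw [eq_neg_of_add_eq_zero_left hsum]
    exact (dvd_neg).2 hrest
  rcases hPi.dvd_or_dvd hmain with h | h
  · rcases hPi.dvd_or_dvd h with h | h
    · exact hPi.not_isUnit (isUnit_of_dvd_unit h ((isUnit_iff_ne_zero.2 hci).map C))
    · obtain ⟨j, hj, hd⟩ := (hPi.dvd_finsetProd_iff _).1 h
      exact hne i j (Finset.ne_of_mem_erase hj).symm hd
  · exact hl h

/-- Vectors fixed by a semilinear map that are linearly independent over the fixed field are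
linearly independent. -/
theorem linearIndependent_of_fixed {k K V : Type*} [Field k] [Field K] [Algebra k K]
    [AddCommGroup V] [Module K V] [Module k V] [IsScalarTower k K V] (Φ : K →+* K)
    (hΦ : ∀ x, Φ x = x → ∃ c, algebraMap k K c = x) (T : V →ₛₗ[Φ] V) :
    ∀ {n : ℕ} {v : Fin n → V}, LinearIndependent k v → (∀ i, T (v i) = v i) →
      LinearIndependent K v := by
  intro n
  induction n with
  | zero => intro v _ _; exact linearIndependent_empty_type
  | succ n ih =>
    intro v hv hT
    rw [linearIndependent_finSucc] at hv ⊢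
    have hi := ih hv.1 fun i => hT i.succ
    refine ⟨hi, fun hmem => hv.2 ?_⟩
    obtain ⟨c, hc⟩ := (Submodule.mem_span_range_iff_exists_fun K).1 hmem
    have h1 : ∑ i, Φ (c i) • Fin.tail v i = v 0 := by
      rw [← hT 0, ← hc, map_sum]
      refine Finset.sum_congr rfl fun i _ => ?_
      rw [T.map_smulₛₗ]
      congr 1
      exact (hT i.succ).symm
    -- Applying `T` to a relation with leading coefficient 1 and subtracting yields a shorter one,
    -- so its coefficients are fixed by `Φ` and come from `k`.
    have h2 : ∑ i, (Φ (c i) - c i) • Fin.tail v i = 0 := by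
      simp only [sub_smul, Finset.sum_sub_distrib, h1, hc, sub_self]
    have h3 : ∀ i, Φ (c i) = c i := fun i =>
      sub_eq_zero.1 (Fintype.linearIndependent_iff.1 hi _ h2 i)
    choose d hd using fun i => hΦ (c i) (h3 i)
    refine (Submodule.mem_span_range_iff_exists_fun k).2 ⟨d, ?_⟩
    rw [← hc]
    refine Finset.sum_congr rfl fun i _ => ?_
    rw [← hd, algebraMap_smul]

section Pullback

variable (g : Fin 2 → MvPolynomial (Fin 2) k) (Φ : RatFunc k →ₐ[k] RatFunc k)

/-- Pullback of differentials along `g`, in the basis `dx, dy`. -/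
def pullbackForm : (Fin 2 → RatFunc k) →ₛₗ[(Φ : RatFunc k →+* RatFunc k)] (Fin 2 → RatFunc k) where
  toFun v := ∑ i, Φ (v i) • grad (g i)
  map_add' v w := by simp only [Pi.add_apply, map_add, add_smul, Finset.sum_add_distrib]
  map_smul' c v := by
    simp only [Pi.smul_apply, smul_eq_mul, map_mul, Finset.smul_sum, mul_smul, RingHom.coe_coe]

variable {g Φ}

theorem pullbackForm_dlog (hΦ : ∀ P, Φ (algebraMap _ _ P) = algebraMap _ _ (bind₁ g P))
    (P : MvPolynomial (Fin 2) k) :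
    pullbackForm g Φ (dlog P) = dlog (bind₁ g P) := by
  have : pullbackForm g Φ (grad P) = grad (bind₁ g P) := by
    funext j
    simp only [pullbackForm, LinearMap.coe_mk, AddHom.coe_mk, grad, hΦ, Finset.sum_apply,
      Pi.smul_apply, smul_eq_mul, pderiv_bind₁ g j P, map_sum, map_mul]
  rw [dlog, LinearMap.map_smulₛₗ, this, dlog]
  simp [hΦ]

theorem bind₁_injective (hΦ : ∀ P, Φ (algebraMap _ _ P) = algebraMap _ _ (bind₁ g P)) :
    Function.Injective (bind₁ g) := by
  intro P Q h
  apply IsFractionRing.injective (MvPolynomial (Fin 2) k) (RatFunc k)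
  exact Φ.toRingHom.injective (by simp [hΦ, h])

/-- If pullback along `g` is surjective on rational functions, then the coordinates are fractions
with numerators `A i ∘ g` and common denominator `B ∘ g`. -/
theorem exists_inverse_fraction (hΦ : ∀ P, Φ (algebraMap _ _ P) = algebraMap _ _ (bind₁ g P))
    (hs : Function.Surjective Φ) :
    ∃ (A : Fin 2 → MvPolynomial (Fin 2) k) (B : MvPolynomial (Fin 2) k), B ≠ 0 ∧
      ∀ i, bind₁ g (A i) = bind₁ g B * X i := by
  choose h hh using fun i : Fin 2 => hs (algebraMap (MvPolynomial (Fin 2) k) _ (X i))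
  obtain ⟨b, hb⟩ := IsLocalization.exist_integer_multiples_of_finite
    (nonZeroDivisors (MvPolynomial (Fin 2) k)) h
  choose A hA using hb
  refine ⟨A, b, nonZeroDivisors.coe_ne_zero b, fun i => ?_⟩
  apply IsFractionRing.injective (MvPolynomial (Fin 2) k) (RatFunc k)
  rw [← hΦ, hA, Algebra.smul_def, map_mul, hΦ, map_mul, hh]

end Pullback

end

/-! ### Finiteness of the set of invariant curves -/

section

variable {k : Type*} [Field k]

section Cofactor
variable {g A : Fin 2 → MvPolynomial (Fin 2) k} {B : MvPolynomial (Fin 2) k}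

/-- Here `w` is `u` composed with the inverse `A / B`, multiplied by a power of `B` that clears the
denominators. -/
theorem exists_bind₁_eq_pow_mul (hA : ∀ i, bind₁ g (A i) = bind₁ g B * X i)
    (u : MvPolynomial (Fin 2) k) :
    ∃ n w, bind₁ g w = bind₁ g B ^ n * u := by
  induction u using MvPolynomial.induction_on with
  | C a => exact ⟨0, C a, by simp⟩
  | add P Q hP hQ =>
    obtain ⟨n, w, hw⟩ := hP
    obtain ⟨m, v, hv⟩ := hQ
    refine ⟨n + m, B ^ m * w + B ^ n * v, ?_⟩
    simp only [map_add, map_mul, map_pow, hw, hv]; ring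
  | mul_X P i hP =>
    obtain ⟨n, w, hw⟩ := hP
    exact ⟨n + 1, w * A i, by rw [map_mul, hw, hA]; ring⟩

/-- If an irreducible curve `P = 0`, not among the curves contracted by `g`,
is invariant, then the cofactor of `P` in `P ∘ g` is made of contracted curves. -/
theorem cofactor_dvd_pow (hg : Function.Injective (bind₁ g))
    (hA : ∀ i, bind₁ g (A i) = bind₁ g B * X i) (hB : B ≠ 0) {P Q : MvPolynomial (Fin 2) k}
    (hP : Irreducible P) (hPE : ¬ P ∣ bind₁ g B) (hQ : bind₁ g P = P * Q) :
    ∃ m, Q ∣ bind₁ g B ^ m := by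
  have hE : bind₁ g B ≠ 0 := fun h => hB (hg (by rw [h, map_zero]))
  set E := bind₁ g B with hEdef
  obtain ⟨n, w, hw⟩ := exists_bind₁_eq_pow_mul hA P
  obtain ⟨m, v, hv⟩ := exists_bind₁_eq_pow_mul hA Q
  have hwv : w * v = B ^ (n + m) * P := hg (by
    rw [map_mul, hw, hv, map_mul, hQ, map_pow]; ring)
  have hPp : Prime P := hP.prime
  rcases hPp.dvd_or_dvd (hwv ▸ Dvd.intro_left _ rfl : P ∣ w * v) with ⟨w', rfl⟩ | ⟨v', rfl⟩
  · have h1 : w' * v = B ^ (n + m) := mul_left_cancel₀ hP.ne_zero (by rw [← mul_assoc, hwv]; ring)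
    refine ⟨n + m, ?_⟩
    have h2 := congrArg (bind₁ g) h1
    rw [map_mul, hv, map_pow] at h2
    rw [← hEdef] at h2
    exact ⟨bind₁ g w' * E ^ m, by rw [← h2]; ring⟩
  · have h1 : w * v' = B ^ (n + m) := mul_left_cancel₀ hP.ne_zero (by
      rw [mul_left_comm, hwv]; ring)
    have h2 := congrArg (bind₁ g) h1
    rw [map_mul, hw, map_pow] at h2
    have h3 : P ∣ E ^ (n + m) := ⟨E ^ n * bind₁ g v', by rw [hEdef, ← h2]; ring⟩
    exact absurd (hPp.dvd_of_dvd_pow h3) hPE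

end Cofactor

/-- `dlog` is additive on products and kills units, so only the irreducible factors of `E`
contribute. -/
theorem dlog_mem_span {E Q : MvPolynomial (Fin 2) k} (hE : E ≠ 0) {m : ℕ} (hQ : Q ∣ E ^ m) :
    dlog Q ∈ Submodule.span k (dlog '' {R | R ∈ UniqueFactorizationMonoid.factors E}) := by
  induction Q using UniqueFactorizationMonoid.induction_on_prime with
  | h₁ => exact absurd (zero_dvd_iff.1 hQ) (pow_ne_zero _ hE)
  | h₂ u hu => rw [dlog_of_isUnit hu]; exact Submodule.zero_mem _
  | h₃ Q p hQ0 hp ih =>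
    rw [dlog_mul hp.ne_zero hQ0]
    refine Submodule.add_mem _ ?_ (ih ((Dvd.intro_left _ rfl).trans hQ))
    obtain ⟨R, hR, u, rfl⟩ := UniqueFactorizationMonoid.exists_mem_factors_of_dvd hE hp.irreducible
      (hp.dvd_of_dvd_pow ((Dvd.intro _ rfl).trans hQ))
    refine Submodule.subset_span ⟨p * u, hR, ?_⟩
    rw [dlog_mul hp.ne_zero u.ne_zero, dlog_of_isUnit u.isUnit, add_zero]

theorem exists_pairwise_not_dvd {s : MvPolynomial (Fin 2) k → Prop}
    (hs : ∀ P, s P → Irreducible P) (hinf : ∀ H, H ≠ 0 → ∃ P, s P ∧ ¬ P ∣ H) (n : ℕ) :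
    ∃ P : Fin n → MvPolynomial (Fin 2) k, (∀ i, s (P i)) ∧ ∀ i j, i ≠ j → ¬ P i ∣ P j := by
  induction n with
  | zero => exact ⟨Fin.elim0, fun i => i.elim0, fun i => i.elim0⟩
  | succ n ih =>
    obtain ⟨P, hP, hne⟩ := ih
    obtain ⟨R, hR, hRP⟩ := hinf (∏ i, P i)
      (Finset.prod_ne_zero_iff.2 fun i _ => (hs _ (hP i)).ne_zero)
    have h1 : ∀ i, ¬ R ∣ P i := fun i h => hRP (h.trans (Finset.dvd_prod_of_mem _ (Finset.mem_univ i)))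
    have h2 : ∀ i, ¬ P i ∣ R := fun i h =>
      h1 i ((hs _ (hP i)).associated_of_dvd (hs _ hR) h).symm.dvd
    refine ⟨Fin.cons R P, Fin.cases hR hP, ?_⟩
    refine Fin.cases (Fin.cases (by simp) fun j _ => by simpa using h1 j) fun i =>
      Fin.cases (fun _ => by simpa using h2 i) fun j hij => ?_
    simpa using hne i j (by simpa using hij)

theorem pullbackForm_smul (g : Fin 2 → MvPolynomial (Fin 2) k) (Φ : RatFunc k →ₐ[k] RatFunc k)
    (c : k) (v : Fin 2 → RatFunc k) : pullbackForm g Φ (c • v) = c • pullbackForm g Φ v := by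
  simp only [pullbackForm, LinearMap.coe_mk, AddHom.coe_mk, Pi.smul_apply, map_smul, smul_assoc,
    Finset.smul_sum]

/-- A birational polynomial map which preserves no nonconstant rational function has
only finitely many invariant irreducible curves. -/
theorem exists_forall_invariant_dvd [CharZero k] {g : Fin 2 → MvPolynomial (Fin 2) k}
    {Φ : RatFunc k →ₐ[k] RatFunc k} (hΦ : ∀ P, Φ (algebraMap _ _ P) = algebraMap _ _ (bind₁ g P))
    (hs : Function.Surjective Φ) (hfix : ∀ x, Φ x = x → IsConstant x) :
    ∃ H : MvPolynomial (Fin 2) k, H ≠ 0 ∧ ∀ P, Irreducible P → P ∣ bind₁ g P → P ∣ H := by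
  obtain ⟨A, B, hB, hA⟩ := exists_inverse_fraction hΦ hs
  have hg := bind₁_injective hΦ
  have hE : bind₁ g B ≠ 0 := fun h => hB (hg (by rw [h, map_zero]))
  set E := bind₁ g B with hEdef
  by_contra! hcon
  have hinf : ∀ H, H ≠ 0 → ∃ P, (Irreducible P ∧ P ∣ bind₁ g P ∧ ¬ P ∣ E) ∧ ¬ P ∣ H := by
    intro H hH
    obtain ⟨P, hP, hPg, hPH⟩ := hcon (H * E) (mul_ne_zero hH hE)
    exact ⟨P, ⟨hP, hPg, fun h => hPH (h.mul_left _)⟩, fun h => hPH (h.mul_right _)⟩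
  set W := Submodule.span k (dlog '' {R | R ∈ UniqueFactorizationMonoid.factors E}) with hW
  have hWfin : Module.Finite k W := Module.Finite.span_of_finite k
    ((Multiset.finite_toSet _).image _)
  -- The surplus 3 over `dim W` leaves a kernel of dimension at least 3 for `δ`, which measures the
  -- failure of invariance: one more than the rank 2 of the forms over `k(x, y)`.
  obtain ⟨P, hP, hne⟩ := exists_pairwise_not_dvd (fun P hP => hP.1) hinf (Module.finrank k W + 3)
  have hli := linearIndependent_dlog (fun i => (hP i).1) hne
  have hT : ∀ i, pullbackForm g Φ (dlog (P i)) - dlog (P i) ∈ W := by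
    intro i
    obtain ⟨hirr, ⟨Q, hQ⟩, hPE⟩ := hP i
    have hQ0 : Q ≠ 0 := by
      rintro rfl
      rw [mul_zero] at hQ
      exact hirr.ne_zero (hg (by rw [hQ, map_zero]))
    rw [pullbackForm_dlog hΦ, hQ, dlog_mul hirr.ne_zero hQ0, add_sub_cancel_left]
    obtain ⟨m, hm⟩ := cofactor_dvd_pow hg hA hB hirr hPE hQ
    exact dlog_mem_span hE hm
  let δ : (Fin (Module.finrank k W + 3) → k) →ₗ[k] W :=
    Fintype.linearCombination k fun i => (⟨_, hT i⟩ : W)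
  let L := Fintype.linearCombination k fun i => dlog (P i)
  have hLinj : Function.Injective L := hli.fintypeLinearCombination_injective
  have hker : 3 ≤ Module.finrank k (LinearMap.ker δ) := by
    have h1 := δ.finrank_range_add_finrank_ker
    have h2 := Submodule.finrank_le (LinearMap.range δ)
    rw [Module.finrank_fin_fun] at h1
    omega
  let b := Module.finBasis k (LinearMap.ker δ)
  have hv : LinearIndependent k fun i => L (b i : Fin (Module.finrank k W + 3) → k) :=
    (b.linearIndependent.map' (L.comp (LinearMap.ker δ).subtype)
      (LinearMap.ker_eq_bot.2 (hLinj.comp Subtype.val_injective)))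
  have hTv : ∀ i, pullbackForm g Φ (L (b i : Fin (Module.finrank k W + 3) → k)) = L (b i) := by
    intro i
    have h0 : (δ (b i) : Fin 2 → RatFunc k) = 0 := by
      rw [LinearMap.mem_ker.1 (b i).2]; rfl
    rw [← sub_eq_zero, ← h0]
    simp only [δ, L, Fintype.linearCombination_apply, map_sum, AddSubmonoidClass.coe_finsetSum,
      Submodule.coe_smul, smul_sub, Finset.sum_sub_distrib]
    congr 1
    refine Finset.sum_congr rfl fun j _ => ?_
    rw [pullbackForm_smul]
  have hK := linearIndependent_of_fixed (k := k) (Φ : RatFunc k →+* RatFunc k)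
    (fun x hx => (hfix x hx).imp fun c hc => hc.symm) (pullbackForm g Φ) hv hTv
  have := hK.fintype_card_le_finrank
  rw [Module.finrank_fin_fun, Fintype.card_fin] at this
  omega

end

/-! ### Iterates, Jacobians, and fixed points tangent to the identity -/

section

section Iterate
variable {A : Type*} [CommRing A]

/-- The components of the `n`-th iterate of a polynomial map. -/
def iter (f : Fin 2 → MvPolynomial (Fin 2) A) : ℕ → Fin 2 → MvPolynomial (Fin 2) A
  | 0 => X
  | n + 1 => fun i => bind₁ (iter f n) (f i)

theorem eval_bind₁_eq (g : Fin 2 → MvPolynomial (Fin 2) A) (P : MvPolynomial (Fin 2) A)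
    (x : Fin 2 → A) : eval x (bind₁ g P) = eval (polyMap g x) P := by
  rw [← coe_aeval_eq_eval, RingHom.coe_coe, aeval_bind₁]; rfl

theorem polyMap_iter (f : Fin 2 → MvPolynomial (Fin 2) A) (n : ℕ) :
    polyMap (iter f n) = (polyMap f)^[n] := by
  induction n with
  | zero => funext x i; simp [iter, polyMap]
  | succ n ih =>
    funext x i
    rw [Function.iterate_succ_apply', ← ih]
    exact eval_bind₁_eq _ _ _

theorem bind₁_iter (f : Fin 2 → MvPolynomial (Fin 2) A) (n : ℕ) (P : MvPolynomial (Fin 2) A) :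
    bind₁ (iter f n) P = (bind₁ f)^[n] P := by
  induction n generalizing P with
  | zero => simp [iter]
  | succ n ih => rw [Function.iterate_succ_apply, ← ih, bind₁_bind₁]; rfl

theorem map_iter {B : Type*} [CommRing B] (φ : A →+* B) (f : Fin 2 → MvPolynomial (Fin 2) A)
    (n : ℕ) (i : Fin 2) : map φ (iter f n i) = iter (fun i => map φ (f i)) n i := by
  induction n generalizing i with
  | zero => simp [iter]
  | succ n ih =>
    simp only [iter, map_bind₁]
    congr 2
    funext i
    exact ih i

theorem map_polyMap {B : Type*} [CommRing B] (φ : A →+* B) (f : Fin 2 → MvPolynomial (Fin 2) A)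
    (x : Fin 2 → A) : polyMap (fun i => map φ (f i)) (φ ∘ x) = φ ∘ polyMap f x := by
  funext i
  simp only [polyMap, Function.comp_apply, eval_map]
  rw [← eval₂_comp]

theorem jacobianAt_map {B : Type*} [CommRing B] (φ : A →+* B) (f : Fin 2 → MvPolynomial (Fin 2) A)
    (x : Fin 2 → A) : jacobianAt (fun i => map φ (f i)) (φ ∘ x) = (jacobianAt f x).map φ := by
  ext i j
  simp only [jacobianAt, Matrix.of_apply, Matrix.map_apply, pderiv_map, eval_map]
  rw [← eval₂_comp]

theorem jacobianAt_bind₁ (f g : Fin 2 → MvPolynomial (Fin 2) A) (x : Fin 2 → A) :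
    jacobianAt (fun i => bind₁ g (f i)) x = jacobianAt f (polyMap g x) * jacobianAt g x := by
  ext i j
  simp only [jacobianAt, Matrix.of_apply, Matrix.mul_apply, pderiv_bind₁, map_sum, map_mul,
    eval_bind₁_eq]

theorem jacobianAt_X (x : Fin 2 → A) : jacobianAt X x = 1 := by
  ext i j
  simp only [jacobianAt, Matrix.of_apply, Matrix.one_apply, pderiv_X]
  by_cases h : i = j
  · simp [h]
  · simp [h]

theorem jacobianAt_iter_of_fixed {f : Fin 2 → MvPolynomial (Fin 2) A} {x : Fin 2 → A}
    (hx : polyMap f x = x) (n : ℕ) : jacobianAt (iter f n) x = jacobianAt f x ^ n := by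
  induction n with
  | zero => exact jacobianAt_X x
  | succ n ih =>
    have : polyMap (iter f n) x = x := by
      rw [polyMap_iter]; exact Function.iterate_fixed hx n
    simp only [iter]
    rw [jacobianAt_bind₁, this, ih, pow_succ']

theorem iter_mul (f : Fin 2 → MvPolynomial (Fin 2) A) (m n : ℕ) :
    iter (iter f m) n = iter f (m * n) := by
  funext i
  have h := bind₁_iter (iter f m) n (X i)
  have h2 := bind₁_iter f (m * n) (X i)
  rw [bind₁_X_right] at h h2
  rw [h, h2, Function.iterate_mul]
  congr 2
  funext P
  exact bind₁_iter f m P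

theorem det_jacobianAt_ne_zero [IsDomain A] {f P : Fin 2 → MvPolynomial (Fin 2) A}
    {Q : MvPolynomial (Fin 2) A} (hPQ : ∀ i, bind₁ f (P i) = bind₁ f Q * X i) {x : Fin 2 → A}
    (hx : eval x (bind₁ f Q) ≠ 0) : (jacobianAt f x).det ≠ 0 := by
  -- Differentiating `P i ∘ f = (Q ∘ f) * X i` shows that `N` is an inverse of the Jacobian up to
  -- the scalar `Q (f x)`.
  set N : Matrix (Fin 2) (Fin 2) A := Matrix.of fun i l =>
    eval (polyMap f x) (pderiv l (P i)) - x i * eval (polyMap f x) (pderiv l Q) with hN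
  have key : N * jacobianAt f x = eval x (bind₁ f Q) • (1 : Matrix (Fin 2) (Fin 2) A) := by
    ext i j
    have h := congrArg (fun p => eval x (pderiv j p)) (hPQ i)
    simp only [pderiv_mul, map_add, map_mul, eval_X, pderiv_X] at h
    rw [pderiv_bind₁, pderiv_bind₁] at h
    simp only [map_sum, map_mul, eval_bind₁_eq _ (pderiv _ _)] at h
    simp only [Matrix.mul_apply, hN, jacobianAt, Matrix.of_apply, Matrix.smul_apply, smul_eq_mul,
      Matrix.one_apply]
    simp only [Fin.sum_univ_two] at h ⊢
    have e : eval x (Pi.single (M := fun _ => MvPolynomial (Fin 2) A) j 1 i) =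
        if i = j then 1 else 0 := by
      by_cases hij : i = j
      · subst hij; simp
      · simp [hij]
    linear_combination h + eval x (bind₁ f Q) * e
  intro hdet
  have h := congrArg Matrix.det key
  rw [Matrix.det_mul, hdet, mul_zero, Matrix.det_smul, Matrix.det_one, mul_one] at h
  exact pow_ne_zero _ hx h.symm

end Iterate

/-- The entries generate a finite extension of `κ`, so the matrix lies in a finite group. -/
theorem exists_matrix_pow_eq_one {κ L : Type*} [Field κ] [Finite κ] [Field L]
    [Algebra κ L] [Algebra.IsAlgebraic κ L] (M : Matrix (Fin 2) (Fin 2) L) (hM : M.det ≠ 0) :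
    ∃ e, 1 ≤ e ∧ M ^ e = 1 := by
  set F := IntermediateField.adjoin κ (Set.range fun t : Fin 2 × Fin 2 => M t.1 t.2) with hF
  have : FiniteDimensional κ F := IntermediateField.finiteDimensional_adjoin fun x _ =>
    (Algebra.IsAlgebraic.isAlgebraic x).isIntegral
  have : Finite F := Module.finite_of_finite κ
  let M' : Matrix (Fin 2) (Fin 2) F :=
    Matrix.of fun i j => ⟨M i j, IntermediateField.subset_adjoin _ _ ⟨(i, j), rfl⟩⟩
  have hMM : M'.map (algebraMap F L) = M := by ext i j; rfl
  have hdet : M'.det ≠ 0 := by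
    intro h
    apply hM
    have := RingHom.map_det (algebraMap F L) M'
    rw [h, map_zero] at this
    rw [← hMM]
    exact this.symm
  obtain ⟨u, hu⟩ := (Matrix.isUnit_iff_isUnit_det M').2 (isUnit_iff_ne_zero.2 hdet)
  have : Finite (Matrix (Fin 2) (Fin 2) F) := inferInstanceAs (Finite (Fin 2 → Fin 2 → F))
  obtain ⟨e, he, hue⟩ := (isOfFinOrder_of_finite u).exists_pow_eq_one
  refine ⟨e, he, ?_⟩
  have h1 : M' ^ e = 1 := by rw [← hu, ← Units.val_pow_eq_pow_val, hue]; rfl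
  have h2 := congrArg (fun N => (algebraMap F L).mapMatrix N) h1
  simp only [map_pow, map_one] at h2
  rw [RingHom.mapMatrix_apply, hMM] at h2
  exact h2

/-- Over an algebraic closure of a finite field, some iterate of a birational polynomial map has a
fixed point at which its Jacobian matrix is the identity. -/
theorem exists_fixed_jacobian_eq_one {κ L : Type*} [Field κ] [Finite κ] [Field L] [IsAlgClosed L]
    [Algebra κ L] [Algebra.IsAlgebraic κ L] {f P : Fin 2 → MvPolynomial (Fin 2) κ}
    {Q : MvPolynomial (Fin 2) κ} (hPQ : ∀ i, bind₁ f (P i) = bind₁ f Q * X i)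
    (hD : bind₁ f (bind₁ f (bind₁ f Q)) ≠ 0) :
    ∃ (M : ℕ) (z : Fin 2 → L), 1 ≤ M ∧
      polyMap (iter (fun i => map (algebraMap κ L) (f i)) M) z = z ∧
      jacobianAt (iter (fun i => map (algebraMap κ L) (f i)) M) z = 1 := by
  -- Off the curve `Q ∘ f = 0` the Jacobian is invertible. Avoiding this curve, already one
  -- composition with `f`, accounts for the third `bind₁ f` in the hypothesis.
  obtain ⟨N, z, hN, hz, hav⟩ := exists_periodic_avoiding (L := L) f (bind₁ f Q) hD
  set fL : Fin 2 → MvPolynomial (Fin 2) L := fun i => map (algebraMap κ L) (f i) with hfL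
  have hpoly : (fun x i => aeval x (f i)) = polyMap fL := by
    funext x i
    simp [polyMap, hfL, eval_map, aeval_def]
  rw [hpoly] at hz hav
  have hPQL : ∀ i, bind₁ fL (map (algebraMap κ L) (P i)) =
      bind₁ fL (map (algebraMap κ L) Q) * X i := by
    intro i
    rw [← map_bind₁, ← map_bind₁, hPQ, map_mul, map_X]
  have hdet : ∀ n, (jacobianAt (iter fL n) z).det ≠ 0 := by
    intro n
    induction n with
    | zero => simp [iter, jacobianAt_X]
    | succ n ih =>
      simp only [iter]
      rw [jacobianAt_bind₁, Matrix.det_mul, polyMap_iter]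
      refine mul_ne_zero (det_jacobianAt_ne_zero hPQL ?_) ih
      rw [← map_bind₁, eval_map, ← aeval_def]
      exact hav n
  obtain ⟨e, he, hone⟩ := exists_matrix_pow_eq_one (κ := κ) _ (hdet N)
  have hfix : polyMap (iter fL N) z = z := by rw [polyMap_iter, hz]
  refine ⟨N * e, z, Nat.mul_pos hN he, ?_, ?_⟩
  · rw [← iter_mul, polyMap_iter]
    exact Function.iterate_fixed hfix e
  · rw [← iter_mul, jacobianAt_iter_of_fixed hfix, hone]

end

/-! ### Reduction modulo maximal ideals of rings of finite type over `ℤ` -/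

section

instance isJacobsonRing_int : IsJacobsonRing ℤ := by
  rw [isJacobsonRing_iff_prime_eq]
  intro P hP
  by_cases h : P = ⊥
  · subst h
    refine le_antisymm (fun x hx => ?_) Ideal.le_jacobson
    -- Membership makes `x * x + 1` a unit of `ℤ`, that is `1` or `-1`, which forces `x = 0`.
    have h1 := (Ideal.mem_jacobson_bot.1 hx) x
    rw [Ideal.mem_bot]
    rcases Int.isUnit_iff.1 h1 with h2 | h2 <;> nlinarith
  · have := hP.isMaximal h
    exact Ideal.jacobson_eq_self_of_isMaximal

/-- By the Nullstellensatz over `ℤ` the residue field is a finite `ℤ`-module. Characteristic 0 would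
make `ℤ` a field, so it is torsion and hence finite. -/
theorem finite_quotient_of_finiteType {R : Type*} [CommRing R] [Algebra.FiniteType ℤ R]
    (m : Ideal R) [m.IsMaximal] : Finite (R ⧸ m) ∧ ∃ p : ℕ, p.Prime ∧ (p : R) ∈ m := by
  let : Field (R ⧸ m) := Ideal.Quotient.field m
  have hfin : Module.Finite ℤ (R ⧸ m) := finite_of_finite_type_of_isJacobsonRing ℤ (R ⧸ m)
  obtain ⟨p, hp⟩ := CharP.exists (R ⧸ m)
  have hp0 : p ≠ 0 := by
    rintro rfl
    have : CharZero (R ⧸ m) := CharP.charP_to_charZero _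
    have hfield : IsField ℤ := isField_of_isIntegral_of_isField
      (FaithfulSMul.algebraMap_injective ℤ (R ⧸ m)) (Field.toIsField (R ⧸ m))
    exact Int.not_isField hfield
  have hpp : p.Prime := (CharP.char_is_prime_or_zero (R ⧸ m) p).resolve_right hp0
  refine ⟨Module.finite_of_fg_torsion _ fun x => ?_, p, hpp, ?_⟩
  · refine ⟨⟨(p : ℤ), mem_nonZeroDivisors_of_ne_zero (by exact_mod_cast hp0)⟩, ?_⟩
    change (p : ℤ) • x = 0
    rw [zsmul_eq_mul, Int.cast_natCast, CharP.cast_eq_zero, zero_mul]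
  · rw [← Ideal.Quotient.eq_zero_iff_mem, map_natCast, CharP.cast_eq_zero]

theorem exists_isMaximal_notMem {R : Type*} [CommRing R] [IsDomain R] [Algebra.FiniteType ℤ R]
    {r : R} (hr : r ≠ 0) : ∃ m : Ideal R, m.IsMaximal ∧ r ∉ m := by
  have : IsJacobsonRing R := isJacobsonRing_of_finiteType (A := ℤ)
  by_contra! h
  have h1 : r ∈ (⊥ : Ideal R).jacobson := by
    rw [Ideal.jacobson, Ideal.mem_sInf]
    exact fun {m} hm => h m hm.2
  rw [IsJacobsonRing.out ‹_› (Ideal.isPrime_bot : (⊥ : Ideal R).IsPrime).isRadical] at h1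
  exact hr h1

theorem isAlgClosed_quotient {S : Type*} [CommRing S]
    (hS : ∀ p : Polynomial S, p.Monic → p.natDegree ≠ 0 → ∃ x, p.eval x = 0) (L : Type*) [Field L]
    (π : S →+* L) (hπ : Function.Surjective π) : IsAlgClosed L := by
  refine IsAlgClosed.of_exists_root _ fun p hp hirr => ?_
  obtain ⟨q, hq, hdeg, hmon⟩ := Polynomial.lifts_and_natDegree_eq_and_monic
    (f := π) (p := p) (by
      rw [Polynomial.lifts_iff_coeff_lifts]
      exact fun n => hπ _) hp
  obtain ⟨x, hx⟩ := hS q hmon (by rw [hdeg]; exact hirr.natDegree_pos.ne')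
  exact ⟨π x, by rw [← hq, Polynomial.eval_map, Polynomial.eval₂_hom, hx, map_zero]⟩

theorem integralClosure_exists_root {R k : Type*} [CommRing R] [Field k] [IsAlgClosed k]
    [Algebra R k] (p : Polynomial (integralClosure R k)) (hp : p.Monic) (hd : p.natDegree ≠ 0) :
    ∃ x, p.eval x = 0 := by
  obtain ⟨x, hx⟩ := IsAlgClosed.exists_root (p.map (algebraMap (integralClosure R k) k)) (by
    rw [hp.degree_map, Polynomial.degree_eq_natDegree hp.ne_zero]
    exact_mod_cast hd)
  have hint : IsIntegral (integralClosure R k) x := ⟨p, hp, by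
    rwa [Polynomial.IsRoot, Polynomial.eval_map] at hx⟩
  have hxR : IsIntegral R x := isIntegral_trans x hint
  refine ⟨⟨x, hxR⟩, Subtype.val_injective ?_⟩
  have : (algebraMap (integralClosure R k) k) (p.eval ⟨x, hxR⟩) = 0 := by
    rw [← Polynomial.eval₂_hom, ← Polynomial.eval_map]
    exact hx
  exact this

/-- Let `S` be integral over `R` and closed under roots of monic polynomials. Modulo a
maximal ideal of `S` with finite trace on `R`, some iterate of a birational map has a fixed point at
which it is tangent to the identity. -/
theorem exists_fixed_jacobian_eq_one_quotient {R S : Type*} [CommRing R] [CommRing S] [Algebra R S]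
    [Algebra.IsIntegral R S]
    (hS : ∀ p : Polynomial S, p.Monic → p.natDegree ≠ 0 → ∃ x, p.eval x = 0)
    (m : Ideal S) [m.IsMaximal] (hfin : Finite (R ⧸ m.comap (algebraMap R S)))
    {f P : Fin 2 → MvPolynomial (Fin 2) R} {Q : MvPolynomial (Fin 2) R}
    (hPQ : ∀ i, bind₁ f (P i) = bind₁ f Q * X i) {d : Fin 2 →₀ ℕ}
    (hd : coeff d (bind₁ f (bind₁ f (bind₁ f Q))) ∉ m.comap (algebraMap R S)) :
    ∃ (M : ℕ) (z : Fin 2 → S ⧸ m), 1 ≤ M ∧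
      polyMap (iter (fun i => map ((Ideal.Quotient.mk m).comp (algebraMap R S)) (f i)) M) z = z ∧
      jacobianAt (iter (fun i => map ((Ideal.Quotient.mk m).comp (algebraMap R S)) (f i)) M) z
        = 1 := by
  let : Field (S ⧸ m) := Ideal.Quotient.field m
  have hmax : (m.comap (algebraMap R S)).IsMaximal :=
    Ideal.isMaximal_comap_of_isIntegral_of_isMaximal m
  let : Field (R ⧸ m.comap (algebraMap R S)) := Ideal.Quotient.field _
  let : Algebra (R ⧸ m.comap (algebraMap R S)) (S ⧸ m) :=
    Ideal.Quotient.algebraQuotientOfLEComap le_rfl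
  have : IsAlgClosed (S ⧸ m) := isAlgClosed_quotient hS _ _ Ideal.Quotient.mk_surjective
  have : IsScalarTower R (R ⧸ m.comap (algebraMap R S)) (S ⧸ m) := IsScalarTower.of_algebraMap_eq' rfl
  have : Algebra.IsIntegral R (S ⧸ m) := Algebra.IsIntegral.of_surjective
    (Ideal.Quotient.mkₐ R m) Ideal.Quotient.mk_surjective
  have : Algebra.IsIntegral (R ⧸ m.comap (algebraMap R S)) (S ⧸ m) := Algebra.IsIntegral.tower_top R
  set μ := Ideal.Quotient.mk (m.comap (algebraMap R S)) with hμ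
  obtain ⟨M, z, hM, hz, hj⟩ := exists_fixed_jacobian_eq_one (L := S ⧸ m)
    (f := fun i => map μ (f i)) (P := fun i => map μ (P i)) (Q := map μ Q)
    (fun i => by rw [← map_bind₁, ← map_bind₁, hPQ, map_mul, map_X])
    (by
      rw [← map_bind₁, ← map_bind₁, ← map_bind₁]
      intro h
      apply hd
      have := congrArg (coeff d) h
      rw [coeff_map, coeff_zero] at this
      exact Ideal.Quotient.eq_zero_iff_mem.1 this)
  refine ⟨M, z, hM, ?_⟩
  simp only [map_map] at hz hj
  exact ⟨hz, hj⟩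

/-- Lifts a fixed point with identity Jacobian over `L` to a disc in `A` on which the iterate is
tangent to the identity. -/
theorem linOn_ker {A L : Type*} [CommRing A] [CommRing L] (ψ : A →+* L)
    (f : Fin 2 → MvPolynomial (Fin 2) A) (z : Fin 2 → A) {M : ℕ}
    (hz : polyMap (iter (fun i => map ψ (f i)) M) (ψ ∘ z) = ψ ∘ z)
    (hj : jacobianAt (iter (fun i => map ψ (f i)) M) (ψ ∘ z) = 1) :
    LinOn (RingHom.ker ψ) (polyMap f)^[M] z z 1 := by
  have hiter : iter (fun i => map ψ (f i)) M = fun i => map ψ (iter f M i) :=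
    funext fun i => (map_iter ψ f M i).symm
  rw [hiter, map_polyMap] at hz
  rw [hiter, jacobianAt_map] at hj
  rw [← polyMap_iter]
  refine ((linOn_polyMap (RingHom.ker ψ) (iter f M) z).congr_right fun i => ?_).congr_matrix
    fun i j => ?_
  · rw [RingHom.mem_ker, map_sub, sub_eq_zero]
    exact congrFun hz i
  · rw [RingHom.mem_ker, map_sub, sub_eq_zero]
    have := congrFun (congrFun hj i) j
    rw [Matrix.map_apply] at this
    rw [this, Matrix.one_apply, Matrix.one_apply]
    split_ifs <;> simp

end

/-! ### The arithmetic model with two residue characteristics -/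

section

theorem exists_map_eq_of_coeffs {k : Type*} [Field k] (R : Subalgebra ℤ k)
    (P : MvPolynomial (Fin 2) k) (h : (P.coeffs : Set k) ⊆ R) :
    ∃ P' : MvPolynomial (Fin 2) R, map (algebraMap R k) P' = P := by
  have : P ∈ Set.range (map (algebraMap R k) : MvPolynomial (Fin 2) R →+* _) := by
    rw [MvPolynomial.mem_range_map_iff_coeffs_subset]
    intro x hx
    exact ⟨⟨x, h hx⟩, rfl⟩
  exact this

theorem exists_quotient_lift_pair {S : Type*} [CommRing S] {m n : Ideal S} (h : IsCoprime m n)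
    (x : S ⧸ m) (y : S ⧸ n) :
    ∃ s, Ideal.Quotient.mk m s = x ∧ Ideal.Quotient.mk n s = y := by
  obtain ⟨s, hs⟩ := Ideal.Quotient.mk_surjective
    ((Ideal.quotientInfEquivQuotientProd m n h).symm (x, y))
  have h1 : Ideal.quotientInfEquivQuotientProd m n h (Ideal.Quotient.mk _ s) = (x, y) := by
    rw [hs, RingEquiv.apply_symm_apply]
  exact ⟨s, congrArg Prod.fst h1, congrArg Prod.snd h1⟩

theorem linOn_ker_of_comp_eq {A R S : Type*} [CommRing A] [CommRing R] [CommRing S] [Algebra R S]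
    {ι : A →+* S} {ρ : R →+* A} (hρ : ι.comp ρ = algebraMap R S) {n : Ideal S}
    {f : Fin 2 → MvPolynomial (Fin 2) R} {M : ℕ} {y : Fin 2 → S ⧸ n} {z : Fin 2 → A}
    (hy : ∀ i, Ideal.Quotient.mk n (ι (z i)) = y i)
    (h1 : polyMap (iter (fun i => map ((Ideal.Quotient.mk n).comp (algebraMap R S)) (f i)) M) y = y)
    (h2 : jacobianAt (iter (fun i => map ((Ideal.Quotient.mk n).comp (algebraMap R S)) (f i)) M) y
      = 1) :
    LinOn (RingHom.ker ((Ideal.Quotient.mk n).comp ι)) (polyMap fun i => map ρ (f i))^[M] z z 1 := by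
  have e1 : (fun i => map ((Ideal.Quotient.mk n).comp ι) (map ρ (f i))) =
      fun i => map ((Ideal.Quotient.mk n).comp (algebraMap R S)) (f i) := by
    funext i
    rw [map_map, RingHom.comp_assoc, hρ]
  have e2 : ((Ideal.Quotient.mk n).comp ι) ∘ z = y := funext hy
  apply linOn_ker
  · rw [e1, e2, h1]
  · rw [e1, e2, h2]

/-- A birational polynomial map over `k` has a model over a noetherian domain `A` in which some
iterate is tangent to the identity at a point modulo ideals of two different residue
characteristics. -/
theorem exists_arithmetic_model {k : Type u} [Field k] [IsAlgClosed k] [CharZero k]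
    {f P : Fin 2 → MvPolynomial (Fin 2) k} {Q : MvPolynomial (Fin 2) k}
    (hf : Function.Injective (bind₁ f)) (hPQ : ∀ i, bind₁ f (P i) = bind₁ f Q * X i) (hQ : Q ≠ 0) :
    ∃ (A : Type u) (_ : CommRing A) (_ : IsDomain A) (_ : Algebra A k) (fA : Fin 2 → MvPolynomial (Fin 2) A) (z : Fin 2 → A) (p q : ℕ)
      (I J : Ideal A) (M : ℕ), IsNoetherianRing A ∧ FaithfulSMul A k ∧
      (∀ i, map (algebraMap A k) (fA i) = f i) ∧
      p.Prime ∧ q.Prime ∧ p ≠ q ∧ I ≠ ⊤ ∧ J ≠ ⊤ ∧ (p : A) ∈ I ∧ (q : A) ∈ J ∧ 1 ≤ M ∧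
      LinOn I (polyMap fA)^[M] z z 1 ∧ LinOn J (polyMap fA)^[M] z z 1 := by
  classical
  set s : Finset k := (f 0).coeffs ∪ (f 1).coeffs ∪ (P 0).coeffs ∪ (P 1).coeffs ∪ Q.coeffs with hs
  set R : Subalgebra ℤ k := Algebra.adjoin ℤ (s : Set k) with hR
  have hsub : ∀ t : Finset k, t ⊆ s → (t : Set k) ⊆ R := fun t ht x hx =>
    Algebra.subset_adjoin (ht hx)
  choose fR hfR using fun i => exists_map_eq_of_coeffs R (f i) (hsub _ (by
    fin_cases i <;> intro x <;> simp [hs] <;> tauto))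
  choose PR hPR using fun i => exists_map_eq_of_coeffs R (P i) (hsub _ (by
    fin_cases i <;> intro x <;> simp [hs] <;> tauto))
  obtain ⟨QR, hQR⟩ := exists_map_eq_of_coeffs R Q (hsub _ (by intro x; simp [hs]; tauto))
  have hinj : Function.Injective (map (algebraMap R k) : MvPolynomial (Fin 2) R →+* _) :=
    map_injective _ Subtype.val_injective
  have hfR' : (fun i => map (algebraMap R k) (fR i)) = f := funext hfR
  have hPQR : ∀ i, bind₁ fR (PR i) = bind₁ fR QR * X i := by
    intro i
    apply hinj
    rw [map_bind₁, map_mul, map_bind₁, map_X, hPR, hQR, hfR', hPQ]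
  have hD : bind₁ fR (bind₁ fR (bind₁ fR QR)) ≠ 0 := by
    intro h
    have := congrArg (map (algebraMap R k)) h
    rw [map_bind₁, map_bind₁, map_bind₁, hfR', hQR, map_zero] at this
    have h0 : ∀ u, bind₁ f u = 0 → u = 0 := fun u hu => hf (by rw [hu, map_zero])
    exact hQ (h0 _ (h0 _ (h0 _ this)))
  obtain ⟨d, hd⟩ := exists_coeff_ne_zero hD
  set r := coeff d (bind₁ fR (bind₁ fR (bind₁ fR QR))) with hr
  have hRft : Algebra.FiniteType ℤ R :=
    Subalgebra.fg_iff_finiteType _ |>.1 (Subalgebra.fg_adjoin_finset s)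
  -- `S` is closed under roots of monic polynomials, so its residue fields are algebraically closed
  -- and the periodic points found there lift to `S`.
  set S := integralClosure R k with hSdef
  have hSroot := integralClosure_exists_root (R := R) (k := k)
  have hker : ∀ m : Ideal R, RingHom.ker (algebraMap R S) ≤ m := by
    intro m x hx
    have : x = 0 := by
      apply Subtype.val_injective
      exact congrArg (fun y : S => (y : k)) (RingHom.mem_ker.1 hx)
    rw [this]; exact m.zero_mem
  obtain ⟨m₁, hm₁, hr₁⟩ := exists_isMaximal_notMem hd
  obtain ⟨hfin₁, p, hp, hpm⟩ := finite_quotient_of_finiteType m₁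
  have hp0 : (p : R) ≠ 0 := Nat.cast_ne_zero.2 hp.ne_zero
  -- Avoiding `p` as well as `r` forces a second residue characteristic `q ≠ p`.
  obtain ⟨m₂, hm₂, hr₂⟩ := exists_isMaximal_notMem (mul_ne_zero hp0 hd)
  obtain ⟨hfin₂, q, hq, hqm⟩ := finite_quotient_of_finiteType m₂
  have hpm₂ : (p : R) ∉ m₂ := fun h => hr₂ (m₂.mul_mem_right _ h)
  have hpq : p ≠ q := by rintro rfl; exact hpm₂ hqm
  obtain ⟨n₁, hn₁, hc₁⟩ := Ideal.exists_ideal_over_maximal_of_isIntegral (S := S) m₁ (hker m₁)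
  obtain ⟨n₂, hn₂, hc₂⟩ := Ideal.exists_ideal_over_maximal_of_isIntegral (S := S) m₂ (hker m₂)
  obtain ⟨M₁, z₁, hM₁, hz₁, hj₁⟩ := exists_fixed_jacobian_eq_one_quotient hSroot n₁
    (by rw [hc₁]; exact hfin₁) hPQR (d := d) (by rw [hc₁]; exact hr₁)
  obtain ⟨M₂, z₂, hM₂, hz₂, hj₂⟩ := exists_fixed_jacobian_eq_one_quotient hSroot n₂
    (by rw [hc₂]; exact hfin₂) hPQR (d := d)
    (by rw [hc₂]; exact fun h => hr₂ (m₂.mul_mem_left _ h))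
  have hcop : IsCoprime n₁ n₂ := by
    rw [Ideal.isCoprime_iff_sup_eq]
    refine hn₁.coprime_of_ne hn₂ ?_
    rintro rfl
    exact hpm₂ (hc₂ ▸ hc₁ ▸ hpm)
  choose w hw₁ hw₂ using fun i => exists_quotient_lift_pair hcop (z₁ i) (z₂ i)
  -- Krull's intersection theorem needs a noetherian ring, so `S` is replaced by a finitely
  -- generated subring containing the coefficients and the common lift `w`.
  set t : Finset k := s ∪ Finset.univ.image fun i => (w i : k) with ht
  set A : Subalgebra ℤ k := Algebra.adjoin ℤ (t : Set k) with hA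
  have hRA : R ≤ A := Algebra.adjoin_mono (by rw [ht]; simp)
  have hAS : ∀ x ∈ A, x ∈ S := by
    intro x hx
    have : A ≤ S.restrictScalars ℤ := by
      refine Algebra.adjoin_le fun y hy => ?_
      rw [ht, Finset.coe_union, Set.mem_union] at hy
      rcases hy with hy | hy
      · exact S.algebraMap_mem ⟨y, Algebra.subset_adjoin hy⟩
      · simp only [Finset.coe_image, Finset.coe_univ, Set.image_univ, Set.mem_range] at hy
        obtain ⟨i, rfl⟩ := hy
        exact (w i).2
    exact this hx
  have hAft : Algebra.FiniteType ℤ A :=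
    Subalgebra.fg_iff_finiteType _ |>.1 (Subalgebra.fg_adjoin_finset t)
  have hnoeth : IsNoetherianRing A := Algebra.FiniteType.isNoetherianRing ℤ A
  let ι : A →+* S :=
    { toFun := fun x => ⟨x.1, hAS x.1 x.2⟩
      map_one' := rfl
      map_mul' := fun _ _ => rfl
      map_zero' := rfl
      map_add' := fun _ _ => rfl }
  let ρ : R →+* A := (Subalgebra.inclusion hRA).toRingHom
  have hρ : ι.comp ρ = algebraMap R S := RingHom.ext fun _ => rfl
  have hzmem : ∀ i, (w i : k) ∈ A := fun i => Algebra.subset_adjoin (by simp [ht])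
  let z : Fin 2 → A := fun i => ⟨w i, hzmem i⟩
  set fA : Fin 2 → MvPolynomial (Fin 2) A := fun i => map ρ (fR i) with hfA
  have h1 := linOn_ker_of_comp_eq hρ (z := z) hw₁ hz₁ hj₁
  have h2 := linOn_ker_of_comp_eq hρ (z := z) hw₂ hz₂ hj₂
  have hmem : ∀ (n : Ideal S) (m : Ideal R) (c : ℕ), n.comap (algebraMap R S) = m → (c : R) ∈ m →
      (c : A) ∈ RingHom.ker ((Ideal.Quotient.mk n).comp ι) := by
    rintro n m c rfl hc
    rw [Ideal.mem_comap, map_natCast] at hc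
    rw [RingHom.mem_ker, map_natCast, ← map_natCast (Ideal.Quotient.mk n),
      Ideal.Quotient.eq_zero_iff_mem]
    exact hc
  have htop : ∀ n : Ideal S, n.IsMaximal → RingHom.ker ((Ideal.Quotient.mk n).comp ι) ≠ ⊤ := by
    intro n hn
    have : Nontrivial (S ⧸ n) := Ideal.Quotient.nontrivial_iff.2 hn.ne_top
    exact RingHom.ker_ne_top _
  refine ⟨A, inferInstance, inferInstance, inferInstance, fA, z, p, q, _, _, M₁ * M₂, hnoeth,
    inferInstance, fun i => ?_, hp, hq, hpq, htop n₁ hn₁, htop n₂ hn₂,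
    hmem n₁ m₁ p hc₁ hpm, hmem n₂ m₂ q hc₂ hqm, Nat.mul_pos hM₁ hM₂, ?_, ?_⟩
  · rw [hfA, map_map, ← hfR]
    rfl
  · simpa [Function.iterate_mul] using h1.iterate M₂
  · simpa [mul_comm M₁, Function.iterate_mul] using h2.iterate M₁

end

/-! ### Recurrence of orbits, iterates of the pullback, and choice of a point -/

section

section Recurrence
variable {A : Type*} [CommRing A] {I : Ideal A}

theorem LinOn.iterate_mul_near {g : (Fin 2 → A) → Fin 2 → A} {a : Fin 2 → A}
    (hg : LinOn I g a a 1) {p : ℕ} (hp : (p : A) ∈ I) (b t : ℕ) {x : Fin 2 → A} (hx : Near I x a) :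
    Near (I ^ (b + 1)) (g^[p ^ b * t] x) x := by
  induction t with
  | zero => exact Near.refl x
  | succ t ih =>
    rw [mul_add, mul_one, add_comm (p ^ b * t), Function.iterate_add_apply]
    exact (hg.iterate_pow_near hp b _ (by simpa using (hg.iterate (p ^ b * t)).maps x hx)).trans ih

/-- Vanishing of a polynomial along the orbit of a map tangent to the identity is a closed
condition in the `p`-adic topology on the set of times. -/
theorem LinOn.eval_iterate_eq_zero {k : Type*} [IsDomain A] [IsNoetherianRing A] [Field k]
    [Algebra A k] [FaithfulSMul A k] {g : (Fin 2 → A) → Fin 2 → A} {a : Fin 2 → A}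
    (hg : LinOn I g a a 1) (hI : I ≠ ⊤) {p : ℕ} (hp : (p : A) ∈ I) {x : Fin 2 → A}
    (hx : Near I x a) (P : MvPolynomial (Fin 2) k) (n : ℕ)
    (h : ∀ b, ∃ t, eval (fun i => algebraMap A k (g^[n + p ^ b * t] x i)) P = 0) :
    eval (fun i => algebraMap A k (g^[n] x i)) P = 0 := by
  refine eval_eq_zero_of_near hI _ P fun s => ?_
  obtain ⟨t, ht⟩ := h s
  refine ⟨_, ?_, ht⟩
  rw [add_comm, Function.iterate_add_apply]
  have hx' : Near I (g^[n] x) a := by simpa using (hg.iterate n).maps x hx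
  exact (hg.iterate_mul_near hp s t hx').mono (Ideal.pow_le_pow_right (Nat.le_succ s))

end Recurrence

/-- A nonzero prime ideal of `k[x, y]` is principal or maximal. -/
theorem isMaximal_of_span_singleton_lt {k : Type*} [Field k] {P : MvPolynomial (Fin 2) k}
    (hP : Prime P) {I : Ideal (MvPolynomial (Fin 2) k)} (hI : I.IsPrime)
    (h : Ideal.span {P} < I) : I.IsMaximal := by
  by_contra hmax
  obtain ⟨m, hm, hIm⟩ := Ideal.exists_le_maximal I hI.ne_top
  have hlt : I < m := lt_of_le_of_ne hIm (by rintro rfl; exact hmax hm)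
  have hPp : (Ideal.span {P}).IsPrime := (Ideal.span_singleton_prime hP.ne_zero).2 hP
  have hbot : (⊥ : Ideal (MvPolynomial (Fin 2) k)) < Ideal.span {P} :=
    bot_lt_iff_ne_bot.2 (by simpa using hP.ne_zero)
  -- The chain `0 < (P) < I < m` would have length 3 in a ring of dimension 2.
  let c : LTSeries (PrimeSpectrum (MvPolynomial (Fin 2) k)) :=
    ((((RelSeries.singleton _ ⟨⊥, Ideal.isPrime_bot⟩).snoc ⟨_, hPp⟩ hbot).snoc ⟨I, hI⟩
      (by simpa using! h)).snoc ⟨m, hm.isPrime⟩ (by simpa using! hlt))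
  have h1 : (c.length : WithBot ℕ∞) ≤ ringKrullDim (MvPolynomial (Fin 2) k) :=
    Order.LTSeries.length_le_krullDim c
  rw [MvPolynomial.ringKrullDim_of_isNoetherianRing, ringKrullDim_eq_zero_of_field] at h1
  have h2 : c.length = 3 := rfl
  rw [h2] at h1
  norm_num at h1

variable {k : Type u} [Field k]

section Pullback
variable [Infinite k] {f : PolyEnd k} (hf : f.IsDominant)

theorem pullback_algebraMap (P : MvPolynomial (Fin 2) k) :
    f.pullback hf (algebraMap _ _ P) = algebraMap _ _ (bind₁ f P) := by
  simp [PolyEnd.pullback]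

/-- The range is a subfield containing `k` and, thanks to the inverse, both coordinates. -/
theorem pullback_surjective (hb : f.IsBirational hf) : Function.Surjective (f.pullback hf) := by
  obtain ⟨h, -, hh⟩ := hb
  have hpoly : ∀ P, algebraMap (MvPolynomial (Fin 2) k) (RatFunc k) P ∈ (f.pullback hf).fieldRange := by
    intro P
    induction P using MvPolynomial.induction_on with
    | C a => exact ⟨algebraMap k _ a, (f.pullback hf).commutes a⟩
    | add P Q hP hQ => rw [map_add]; exact add_mem hP hQ
    | mul_X P i hP => rw [map_mul]; exact mul_mem hP ⟨h i, hh i⟩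
  intro x
  obtain ⟨a, b, -, rfl⟩ := IsFractionRing.div_surjective (A := MvPolynomial (Fin 2) k) x
  exact div_mem (hpoly a) (hpoly b)

end Pullback

theorem pow_apply_eq_iterate (Φ : RatFunc k →ₐ[k] RatFunc k) (n : ℕ) (x : RatFunc k) :
    (Φ ^ n) x = Φ^[n] x := by
  induction n generalizing x with
  | zero => rfl
  | succ n ih => rw [pow_succ, AlgHom.mul_apply, ih]; rfl

theorem pow_algebraMap {f : PolyEnd k} {Φ : RatFunc k →ₐ[k] RatFunc k}
    (hΦ : ∀ P, Φ (algebraMap _ _ P) = algebraMap _ _ (bind₁ f P)) (n : ℕ)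
    (P : MvPolynomial (Fin 2) k) :
    (Φ ^ n) (algebraMap _ _ P) = algebraMap _ _ (bind₁ (iter f n) P) := by
  rw [pow_apply_eq_iterate, bind₁_iter]
  induction n with
  | zero => rfl
  | succ n ih => rw [Function.iterate_succ_apply', ih, hΦ, Function.iterate_succ_apply']

/-- If `Φ` fixes only constants, then so do its iterates. -/
theorem isConstant_of_pow_fixed [IsAlgClosed k] {Φ : RatFunc k →ₐ[k] RatFunc k}
    (hfix : ∀ x, Φ x = x → IsConstant x) {n : ℕ} (hn : 1 ≤ n) {x : RatFunc k}
    (hx : (Φ ^ n) x = x) : IsConstant x := by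
  -- `Φ` permutes the roots cyclically, so the coefficients are fixed, hence constant. Thus `x` is
  -- algebraic over the algebraically closed field `k`.
  set p : Polynomial (RatFunc k) := ∏ i ∈ Finset.range n, (Polynomial.X - Polynomial.C (Φ^[i] x))
    with hp
  have hmap : p.map (Φ : RatFunc k →+* RatFunc k) = p := by
    rw [pow_apply_eq_iterate] at hx
    simp only [hp, Polynomial.map_prod, Polynomial.map_sub, Polynomial.map_X, Polynomial.map_C,
      RingHom.coe_coe, ← Function.iterate_succ_apply']
    obtain ⟨m, rfl⟩ := Nat.exists_eq_add_of_le' hn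
    rw [Finset.prod_range_succ, hx, Finset.prod_range_succ']
    rfl
  have hlift : p ∈ Polynomial.lifts (algebraMap k (RatFunc k)) := by
    rw [Polynomial.lifts_iff_coeff_lifts]
    intro m
    have := congrArg (fun q => Polynomial.coeff q m) hmap
    simp only [Polynomial.coeff_map, RingHom.coe_coe] at this
    obtain ⟨c, hc⟩ := hfix _ this
    exact ⟨c, hc.symm⟩
  obtain ⟨q, hq, -, hmon⟩ := Polynomial.lifts_and_degree_eq_and_monic hlift
    (Polynomial.monic_prod_of_monic _ _ fun i _ => Polynomial.monic_X_sub_C _)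
  have hroot : p.eval x = 0 := by
    rw [hp, Polynomial.eval_prod]
    exact Finset.prod_eq_zero (Finset.mem_range.2 hn) (by simp)
  have hint : IsIntegral k x := ⟨q, hmon, by rw [← Polynomial.eval_map, hq, hroot]⟩
  have hdeg : (minpoly k x).degree = 1 :=
    IsAlgClosed.degree_eq_one_of_irreducible k (minpoly.irreducible hint)
  obtain ⟨c, hc⟩ := minpoly.mem_range_of_degree_eq_one k x hdeg
  exact ⟨c, hc.symm⟩

theorem not_isConstant_coord (i : Fin 2) : ¬ IsConstant (coord k i) := by
  rintro ⟨c, hc⟩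
  rw [coord, IsScalarTower.algebraMap_apply k (MvPolynomial (Fin 2) k) (RatFunc k)] at hc
  have h := congrArg totalDegree (IsFractionRing.injective (MvPolynomial (Fin 2) k) (RatFunc k) hc)
  simp [algebraMap_eq] at h

theorem exists_near_eval_ne_zero [CharZero k] {A : Type*} [CommRing A] [Algebra A k] (z : Fin 2 → A)
    {I J : Ideal A} {p q : ℕ} (hp : p ≠ 0) (hq : q ≠ 0) (hpI : (p : A) ∈ I) (hqJ : (q : A) ∈ J)
    {H : MvPolynomial (Fin 2) k} (hH : H ≠ 0) :
    ∃ w : Fin 2 → A, Near I w z ∧ Near J w z ∧ eval (fun i => algebraMap A k (w i)) H ≠ 0 := by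
  -- Translating `z` by integer multiples of `p * q` respects both congruences, and in
  -- characteristic 0 such points form an infinite grid.
  let s : Fin 2 → Set k := fun i =>
    Set.range fun n : ℕ => algebraMap A k (z i + (p : A) * q * n)
  have hs : ∀ i, (s i).Infinite := fun i => Set.infinite_range_of_injective fun m n h => by
    have hpk : (p : k) ≠ 0 := Nat.cast_ne_zero.2 hp
    have hqk : (q : k) ≠ 0 := Nat.cast_ne_zero.2 hq
    simpa [hpk, hqk] using h
  by_contra! hcon
  refine hH (funext_set s hs fun x hx => ?_)
  choose n hn using fun i => hx i (Set.mem_univ i)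
  rw [map_zero, ← hcon (fun i => z i + (p : A) * q * n i) (fun i => ?_) (fun i => ?_)]
  · congr 2
    exact _root_.funext fun i => (hn i).symm
  · rw [add_sub_cancel_left]
    exact I.mul_mem_right _ (I.mul_mem_right _ hpI)
  · rw [add_sub_cancel_left]
    exact J.mul_mem_right _ (J.mul_mem_left _ hqJ)

end

/-! ### Existence of a dense orbit -/

section

variable {k : Type u} [Field k]

/-- A birational polynomial map preserving no nonconstant rational function has a point with
Zariski dense orbit. -/
theorem exists_zariskiDense_orbit [IsAlgClosed k] [CharZero k] {f : PolyEnd k}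
    {Φ : RatFunc k →ₐ[k] RatFunc k} (hΦ : ∀ P, Φ (algebraMap _ _ P) = algebraMap _ _ (bind₁ f P))
    (hs : Function.Surjective Φ) (hfix : ∀ x, Φ x = x → IsConstant x) :
    ∃ p : Point k, ZariskiDense (f.orbit p) := by
  obtain ⟨N, Q, hQ, hNQ⟩ := exists_inverse_fraction hΦ hs
  obtain ⟨A, _, _, _, fA, z, p, q, I, J, M, _, _, hfA, hp, hq, hpq, hI, hJ, hpI, hqJ, hM, hlI,
    hlJ⟩ := exists_arithmetic_model (bind₁_injective hΦ) hNQ hQ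
  set g := iter f M with hg
  have hΨ := pow_algebraMap hΦ M
  have hΨs : Function.Surjective (Φ ^ M) := fun x => by
    obtain ⟨y, hy⟩ := hs.iterate M x
    exact ⟨y, by rw [pow_apply_eq_iterate, hy]⟩
  have hΨfix : ∀ x, (Φ ^ M) x = x → IsConstant x := fun x => isConstant_of_pow_fixed hfix hM
  obtain ⟨H₁, hH₁, hinv⟩ := exists_forall_invariant_dvd hΨ hΨs hΨfix
  obtain ⟨l, hl⟩ : ∃ l, g l - X l ≠ 0 := by
    by_contra! hcon
    refine not_isConstant_coord (k := k) 0 (hΨfix _ ?_)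
    rw [coord, hΨ, bind₁_X_right, ← sub_eq_zero.1 (hcon 0)]
  -- `w` lies on no invariant irreducible curve of `g`, and `g` moves its `l`-th coordinate.
  obtain ⟨w, hwI, hwJ, hwH⟩ := exists_near_eval_ne_zero z hp.ne_zero hq.ne_zero hpI hqJ
    (mul_ne_zero hH₁ hl)
  rw [map_mul] at hwH
  set gA := (polyMap fA)^[M] with hgA
  let pt : ℕ → Point k := fun n i => algebraMap A k (gA^[n] w i)
  have hpt : ∀ n, polyMap g (pt n) = pt (n + 1) := by
    intro n
    have h1 : g = fun i => map (algebraMap A k) (iter fA M i) := by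
      funext i
      rw [map_iter, hg]
      congr 1
      exact funext fun j => (hfA j).symm
    have h2 := map_polyMap (algebraMap A k) (iter fA M) (gA^[n] w)
    rw [← h1, polyMap_iter fA, ← hgA] at h2
    change polyMap g (algebraMap A k ∘ gA^[n] w) = _
    rw [h2, ← Function.iterate_succ_apply' gA]
    rfl
  have hZI := fun P n => hlI.eval_iterate_eq_zero (k := k) hI hpI hwI P n
  have hZJ := fun P n => hlJ.eval_iterate_eq_zero (k := k) hJ hqJ hwJ P n
  have hprime : (⨅ n, RingHom.ker (eval (pt n))).IsPrime := by
    refine isPrime_of_recurrent (bind₁ g : MvPolynomial (Fin 2) k →+* MvPolynomial (Fin 2) k)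
      (fun n => eval (pt n)) (fun n => ?_) (fun P h => ?_) (fun P m hm h n => ?_)
    · refine RingHom.ext fun P => ?_
      rw [RingHom.comp_apply, RingHom.coe_coe, eval_bind₁_eq, hpt]
    -- Time 0 is the `p`-adic limit of the positive times `p ^ b`.
    · refine hZI P 0 fun b => ⟨1, ?_⟩
      obtain ⟨c, hc⟩ := Nat.exists_eq_add_of_le' (Nat.pow_pos (n := b) hp.pos)
      rw [zero_add, mul_one, hc]
      exact h c
    · exact forall_of_forall_mul hp hq hpq (Z := fun n => eval (pt n) P = 0) (hZI P) (hZJ P) hm h n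
  set 𝔞 : Ideal (MvPolynomial (Fin 2) k) := ⨅ n, RingHom.ker (eval (pt n)) with h𝔞
  have hmem : ∀ P, P ∈ 𝔞 ↔ ∀ n, eval (pt n) P = 0 := fun P => by simp [h𝔞, RingHom.mem_ker]
  by_cases hbot : 𝔞 = ⊥
  · refine ⟨pt 0, ?_⟩
    have hle : vanishingIdeal k (f.orbit (pt 0)) ≤ 𝔞 := by
      intro P hP
      rw [hmem]
      intro n
      have horb : pt n = (PolyEnd.toMap f)^[M * n] (pt 0) := by
        induction n with
        | zero => rfl
        | succ n ih =>
          rw [← hpt, ih, hg, polyMap_iter, mul_add, mul_one, add_comm, Function.iterate_add_apply]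
          rfl
      rw [horb]
      exact hP _ ⟨M * n, rfl⟩
    rw [hbot, le_bot_iff] at hle
    rw [ZariskiDense, hle, zeroLocus_bot]
    rfl
  exfalso
  obtain ⟨P, hP𝔞, hP⟩ := hprime.exists_mem_prime_of_ne_bot hbot
  have hle : Ideal.span {P} ≤ 𝔞 := (Ideal.span_singleton_le_iff_mem _).2 hP𝔞
  -- If the ideal is principal, the orbit closure is an invariant curve through `w`. Otherwise the
  -- ideal is maximal, so it is the ideal of each `pt n`; then `pt 1` and `pt 0` agree, although `g`
  -- moves `w`.
  rcases hle.eq_or_lt with heq | hlt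
  · have hPg : bind₁ g P ∈ 𝔞 := by
      rw [hmem] at hP𝔞 ⊢
      intro n
      rw [eval_bind₁_eq, hpt]
      exact hP𝔞 (n + 1)
    rw [← heq, Ideal.mem_span_singleton] at hPg
    obtain ⟨R, hR⟩ := hinv P hP.irreducible hPg
    refine left_ne_zero_of_mul hwH ?_
    rw [hR, map_mul]
    change eval (pt 0) P * _ = 0
    rw [(hmem P).1 hP𝔞 0, zero_mul]
  · have hmax := isMaximal_of_span_singleton_lt hP hprime hlt
    have hker : ∀ n, 𝔞 = RingHom.ker (eval (pt n)) := fun n =>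
      hmax.eq_of_le (RingHom.ker_ne_top _) (iInf_le _ n)
    have h0 : X l - C (pt 0 l) ∈ 𝔞 := by
      rw [hker 0, RingHom.mem_ker]; simp
    rw [hker 1, RingHom.mem_ker, map_sub, eval_X, eval_C, ← hpt] at h0
    refine right_ne_zero_of_mul hwH ?_
    rw [map_sub, eval_X]
    exact h0

end

end AffinePlane

end

theorem corollary7p2 {k : Type*} [Field k] [IsAlgClosed k] [CharZero k]
    (f : AffinePlane.PolyEnd k) (hdom : AffinePlane.PolyEnd.IsDominant f)
    (hf : AffinePlane.PolyEnd.IsBirational f hdom) :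
    (∃ g : AffinePlane.RatFunc k,
        ¬ AffinePlane.IsConstant g ∧ AffinePlane.PolyEnd.pullback f hdom g = g) ∨
      ∃ p : AffinePlane.Point k,
        AffinePlane.ZariskiDense (AffinePlane.PolyEnd.orbit f p) := by
  refine or_iff_not_imp_left.2 fun h => ?_
  push Not at h
  exact AffinePlane.exists_zariskiDense_orbit (AffinePlane.pullback_algebraMap hdom)
    (AffinePlane.pullback_surjective hdom hf) fun x hx => by_contra fun hc => h x hc hx
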